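/- Let $d\in\{1,2,3\}$ and let $\mathcal S\subset\mathbb R^d$ be a bounded open convex interval ($d=1$), polygon ($d=2$) or polyhedron ($d=3$). Let $A\in W^{1,\infty}(\mathcal S;\mathbb R^{d\times d})$, identified with its continuous representative, be symmetric and uniformly elliptic, i.e. $A(x)\xi\cdot\xi\ge\alpha|\xi|^2$ for some $\alpha>0$ and all $x\in\mathcal S$, $\xi\in\mathbb R^d$, and let $\kappa\in W^{1,\infty}(\mathcal S)$ satisfy $\kappa\ge\kappa_0$ almost everywhere for some constant $\kappa_0>0$. Fix homogeneous Dirichlet or homogeneous Neumann boundary conditions. Let $\{\mathcal T_h\}$ be a family of conforming simplicial triangulations of $\overline{\mathcal S}$, with $h=\max_{K\in\mathcal T_h}\operatorname{diam}K$, which is shape regular: there is $\sigma>0$ such that every element $K$ of every $\mathcal T_h$ contains a ball of diameter at least $\sigma\operatorname{diam}K$. Let the active vertices $\mathcal Z_h^{\mathrm{act}}$ be the vertices of $\mathcal T_h$ not lying on $\partial\mathcal S$ in the Dirichlet case, and all vertices of $\mathcal T_h$ in the Neumann case, and let $V_h$ be the space of continuous functions on $\overline{\mathcal S}$ that are affine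 on each element and vanish at the vertices that are not active (the span of the nodal basis functions of the active vertices). For a vertex $z$ of an element $K$ let $\mathcal A_z(K)$ be the convex hull of the barycenters of all faces of $K$ (of dimensions $0,\dots,d$) that contain $z$, let $b_z=\bigcup_{K\ni z}\mathcal A_z(K)$ be the barycentric dual cell of $z$, with outward unit normal $\eta$, and put $Q\chi=\sum_{z\in\mathcal Z_h^{\mathrm{act}}}\chi(z)\mathbf 1_{b_z}$. For a bounded matrix field $B$ that is either continuous on $\mathcal S$ or constant in the interior of each element, define the box bilinear form $$a_h^B(\chi,\psi)=-\sum_{z\in\mathcal Z_h^{\mathrm{act}}}\psi(z)\int_{\partial b_z\setminus\partial\mathcal S}B\nabla\chi\cdot\eta\,dS+\int_{\mathcal S}\kappa^2\,Q\chi\,Q\psi\,dx,\qquad \chi,\psi\in V_h .$$ Let $A_h$ be the elementwise average of $A$: $A_h|_K=\frac1{|K|}\int_KA(x)\,dx$ for $K\in\mathcal T_h$. Then there exist $c>0$ and $h_0>0$, independent of $h$, such that $$a_h^A(\chi,\chi)\ge c\,\|\chi\|_{H^1(\mathcal S)}^2\quad\text{and}\quad a_h^{A_h}(\chi,\chi)\ge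 c\,\|\chi\|_{H^1(\mathcal S)}^2\qquad\text{for all }\chi\in V_h,\ 0<h<h_0,$$ where $\|\chi\|_{H^1(\mathcal S)}^2=\|\chi\|_{L^2(\mathcal S)}^2+\|\nabla\chi\|_{L^2(\mathcal S)}^2$. -/

import Mathlib

open MeasureTheory
open scoped ENNReal ContDiff

noncomputable section

namespace BoxMethod

/-- `ℝ^d` with its Euclidean norm. -/
abbrev Pt (d : ℕ) : Type := EuclideanSpace ℝ (Fin d)

/-- A bounded open convex polytopal domain of `ℝ^d` (an interval for `d = 1`, a convex polygon for
`d = 2`, a convex polyhedron for `d = 3`): the nonempty interior of the convex hull of finitely many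
points. -/
def IsConvexPolytopalDomain {d : ℕ} (S : Set (Pt d)) : Prop :=
  S.Nonempty ∧ ∃ F : Finset (Pt d), S = interior (convexHull ℝ (F : Set (Pt d)))

/-- `g` is the weak `i`-th partial derivative of `f` on the open set `S`. -/
def IsWeakPartialDeriv {d : ℕ} (S : Set (Pt d)) (i : Fin d) (f g : Pt d → ℝ) : Prop :=
  ∀ φ : Pt d → ℝ, ContDiff ℝ ∞ φ → HasCompactSupport φ → tsupport φ ⊆ S →
    ∫ x in S, f x * fderiv ℝ φ x (EuclideanSpace.single i (1 : ℝ)) = - ∫ x in S, g x * φ x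

/-- `f ∈ W^{1,∞}(S)`: `f` and its weak first partial derivatives are in `L^∞(S)`. -/
def MemW1Inf {d : ℕ} (S : Set (Pt d)) (f : Pt d → ℝ) : Prop :=
  MemLp f ∞ (volume.restrict S) ∧
    ∀ i, ∃ g : Pt d → ℝ, MemLp g ∞ (volume.restrict S) ∧ IsWeakPartialDeriv S i f g

/-- The two homogeneous boundary conditions. -/
inductive BoundaryCondition
  | dirichlet
  | neumann

/-- A conforming simplicial triangulation of the closure of `S`: a finite simplicial complex, all of
whose faces lie in `d`-dimensional simplices of the complex, and whose union is `closure S`. -/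
structure Triangulation {d : ℕ} (S : Set (Pt d)) extends
    Geometry.SimplicialComplex ℝ (Pt d) where
  finite_faces : toSimplicialComplex.faces.Finite
  pure : ∀ s ∈ toSimplicialComplex.faces,
    ∃ K ∈ toSimplicialComplex.faces, s ⊆ K ∧ K.card = d + 1
  space_eq : toSimplicialComplex.space = closure S

/-- `ρ_K`, the diameter of the largest ball contained in `K`. -/
def inscribedDiam {d : ℕ} (K : Set (Pt d)) : ℝ :=
  sSup {δ : ℝ | ∃ (x : Pt d) (r : ℝ), 0 ≤ r ∧ δ = 2 * r ∧ Metric.closedBall x r ⊆ K}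

/-- The region `A_z(K)`: the convex hull of the barycenters of all faces of `K` (of all dimensions
`0, …, d`) that contain the vertex `z`. Simplices are given by their vertex sets. -/
def cornerCell {d : ℕ} (K : Finset (Pt d)) (z : Pt d) : Set (Pt d) :=
  convexHull ℝ {p | ∃ F : Finset (Pt d), F ⊆ K ∧ z ∈ F ∧ p = F.centroid ℝ id}

/-- `η` is the outward unit normal to `C` at `x`: near `x`, the set `C` is the half-space
`{y | ⟪y - x, η⟫ ≤ 0}`. -/
def IsOutwardUnitNormal {d : ℕ} (C : Set (Pt d)) (x η : Pt d) : Prop :=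
  ‖η‖ = 1 ∧ ∃ ε > 0, ∀ y ∈ Metric.ball x ε, y ∈ C ↔ inner ℝ (y - x) η ≤ 0

open Classical in
/-- The outward unit normal field on the boundary of a polytopal set `C`. It is determined at all
boundary points outside the `(d-2)`-dimensional skeleton, which has zero surface measure; there the
value is `0` by convention. -/
def outwardNormal {d : ℕ} (C : Set (Pt d)) (x : Pt d) : Pt d :=
  if h : ∃ η, IsOutwardUnitNormal C x η then h.choose else 0

namespace Triangulation

variable {d : ℕ} {S : Set (Pt d)} (T : Triangulation S)

theorem finite_vertices : T.vertices.Finite := by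
  rw [Geometry.SimplicialComplex.vertices_eq]
  exact T.finite_faces.biUnion fun s _ => s.finite_toSet

open Classical in
/-- The elements of the triangulation: the `d`-dimensional simplices, given by vertex sets. -/
def elements : Finset (Finset (Pt d)) :=
  T.finite_faces.toFinset.filter fun K => K.card = d + 1

/-- The mesh size `h = max_K diam K`. -/
def meshSize : ℝ :=
  sSup ((fun K : Finset (Pt d) => Metric.diam (convexHull ℝ (K : Set (Pt d)))) ''
    (T.elements : Set (Finset (Pt d))))

open Classical in
/-- The active vertices: the vertices not on `∂S` for the Dirichlet condition, and all vertices for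
the Neumann condition. -/
def activeVertices (bc : BoundaryCondition) : Finset (Pt d) :=
  match bc with
  | .dirichlet => T.finite_vertices.toFinset.filter fun z => z ∉ frontier S
  | .neumann => T.finite_vertices.toFinset

/-- The conforming `P₁` space `V_h`: the functions that are continuous on `closure S`, affine on each
element and zero at the vertices that are not active (the span of the nodal basis functions of the
active vertices). As functions on `ℝ^d` they are extended by zero outside `closure S`. -/
def trialSpace (bc : BoundaryCondition) : Submodule ℝ (Pt d → ℝ) where
  carrier := {χ | ContinuousOn χ (closure S) ∧
    (∀ K ∈ T.elements, ∃ g : Pt d →ᵃ[ℝ] ℝ, Set.EqOn χ g (convexHull ℝ (K : Set (Pt d)))) ∧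
    (∀ z ∈ T.vertices, z ∉ T.activeVertices bc → χ z = 0) ∧
    ∀ x ∉ closure S, χ x = 0}
  add_mem' := by
    rintro χ ψ ⟨h1, h2, h3, h4⟩ ⟨k1, k2, k3, k4⟩
    refine ⟨h1.add k1, fun K hK => ?_, fun z hz hz' => ?_, fun x hx => ?_⟩
    · obtain ⟨g, hg⟩ := h2 K hK
      obtain ⟨g', hg'⟩ := k2 K hK
      exact ⟨g + g', fun x hx => by simp [hg hx, hg' hx]⟩
    · simp [h3 z hz hz', k3 z hz hz']
    · simp [h4 x hx, k4 x hx]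
  zero_mem' := ⟨continuousOn_const, fun _ _ => ⟨0, fun _ _ => by simp⟩, fun _ _ _ => rfl,
    fun _ _ => rfl⟩
  smul_mem' := by
    rintro c χ ⟨h1, h2, h3, h4⟩
    refine ⟨h1.const_smul c, fun K hK => ?_, fun z hz hz' => ?_, fun x hx => ?_⟩
    · obtain ⟨g, hg⟩ := h2 K hK
      exact ⟨c • g, fun x hx => by simp [hg hx]⟩
    · simp [h3 z hz hz']
    · simp [h4 x hx]

/-- The dual control volume `b_z = ⋃_{K ∋ z} A_z(K)`. -/
def dualCell (z : Pt d) : Set (Pt d) :=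
  ⋃ K ∈ T.elements, ⋃ _ : z ∈ K, cornerCell K z

/-- The transfer operator `Qχ = ∑_z χ(z) 1_{b_z}`, the sum being over the active vertices. -/
def transfer (bc : BoundaryCondition) (χ : Pt d → ℝ) (x : Pt d) : ℝ :=
  ∑ z ∈ T.activeVertices bc, χ z * (T.dualCell z).indicator 1 x

/-- The outward flux of `B ∇χ` through the part of `∂b_z` that does not lie on `∂S`, with respect to
the `(d-1)`-dimensional surface measure. (For vertices in the interior of `S`, `∂b_z` does not meet
`∂S`; for boundary vertices, the flux through `∂b_z ∩ ∂S` is dropped by the Neumann condition.) -/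
def flux (B : Pt d → Matrix (Fin d) (Fin d) ℝ) (χ : Pt d → ℝ) (z : Pt d) : ℝ :=
  ∫ x in frontier (T.dualCell z) \ frontier S,
    (B x).mulVec (gradient χ x).ofLp ⬝ᵥ (outwardNormal (T.dualCell z) x).ofLp ∂μHE[d - 1]

/-- The box bilinear form
`a_h^B(χ, ψ) = - ∑_z ψ(z) ∫_{∂b_z} B ∇χ · η dS + ∫_S κ² Qχ Qψ dx`. -/
def boxForm (bc : BoundaryCondition) (κ : Pt d → ℝ) (B : Pt d → Matrix (Fin d) (Fin d) ℝ)
    (χ ψ : Pt d → ℝ) : ℝ :=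
  - ∑ z ∈ T.activeVertices bc, ψ z * T.flux B χ z
    + ∫ x in S, κ x ^ 2 * T.transfer bc χ x * T.transfer bc ψ x

/-- The elementwise average `A_h`, equal to `|K|⁻¹ ∫_K A` in the interior of each element `K`. (It is
set to zero on the boundaries of the elements, which meet the relevant part of every `∂b_z` in a set
of surface measure zero.) -/
def elementAverage (A : Pt d → Matrix (Fin d) (Fin d) ℝ) (x : Pt d) :
    Matrix (Fin d) (Fin d) ℝ :=
  ∑ K ∈ T.elements, (interior (convexHull ℝ (K : Set (Pt d)))).indicator
    (fun _ => Matrix.of fun i j => ⨍ y in convexHull ℝ (K : Set (Pt d)), A y i j) x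

end Triangulation

/-- The family of triangulations is shape regular with constant `σ`: `ρ_K ≥ σ h_K` for all elements
of all its members. -/
def ShapeRegular {d : ℕ} {S : Set (Pt d)} {ι : Type*} (T : ι → Triangulation S) (σ : ℝ) : Prop :=
  ∀ i, ∀ K ∈ (T i).elements,
    σ * Metric.diam (convexHull ℝ (K : Set (Pt d))) ≤ inscribedDiam (convexHull ℝ (K : Set (Pt d)))

/-- The square of the `H¹(S)` norm of a continuous piecewise affine function, whose weak gradient is
its classical gradient, defined almost everywhere. -/
def h1NormSq {d : ℕ} (S : Set (Pt d)) (χ : Pt d → ℝ) : ℝ :=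
  (∫ x in S, χ x ^ 2) + ∫ x in S, ‖gradient χ x‖ ^ 2

end BoxMethod

end

/-! Inside an element `K` with vertices `i`, `j`, …, the dual cell of `i` is the region where the
barycentric coordinate `λ_i` is maximal, so the dual cells of `i` and `j` meet in a piece `F_ij` of
the hyperplane `λ_i = λ_j`, with unit normal parallel to `∇(λ_j - λ_i)`. The key fact is `|F_ij|
η_ij = m |K| ∇(λ_j - λ_i)` with `m` depending on `d` only: a prism over `F_ij` is described by
barycentric inequalities alone, and affine maps preserve ratios of volumes
(`exists_facetConstant_cornerConstant`).

For a constant flux `w` on `K` and an affine `g`, the relation `∑ ∇λ_j = 0` then turns `-∑_i g(i)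
∑_j |F_ij| w · η_ij` into `(d+1) m |K| w · ∇g`, a finite element energy. If the flux deviates from
`w` by at most `δ |∇g|`, the errors on `F_ij` are antisymmetric in `i`, `j`, so only differences
`g(i) - g(j)` see them. Since `|b_i - b_j| |∇(λ_j - λ_i)|` is bounded by shape regularity, the total
error is at most a constant times `δ |K| |∇g|²` (`element_flux_ge`), and a small `δ` leaves half of
the ellipticity.

Summation over the elements gives the gradient part (`sum_flux_eq`). The geometric input is that, up
to surface measure zero, `∂b_z` inside the domain is the disjoint union of the pieces `F_zj`
(`ae_eq_iUnion_facets`). In the reaction term, `Qχ = χ(i)` on the corner of `i`, which fills a fixed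
fraction of `K`; this controls the vertex values, hence the `L²` norm (`mass_ge`, `h1NormSq_le`).

Both coefficient fields fit this scheme (`boxForm_ge`): `A` is Lipschitz
(`MemW1Inf.exists_lipschitz`), so `δ = O(h)`, while the averages are constant on each element and
inherit ellipticity, so `δ = 0`. -/

noncomputable section

namespace BoxMethod

/-! ### Affine functions, surface measure of flat sets, affine transport of volume -/

section

set_option linter.unusedSectionVars false

variable {d : ℕ}

/-- The constant gradient of an affine function. -/
def affineGrad (g : Pt d →ᵃ[ℝ] ℝ) : Pt d :=
  (InnerProductSpace.toDual ℝ (Pt d)).symm (LinearMap.toContinuousLinearMap g.linear)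

theorem inner_affineGrad (g : Pt d →ᵃ[ℝ] ℝ) (v : Pt d) :
    inner ℝ (affineGrad g) v = g.linear v := by
  simp [affineGrad]

@[simp]
theorem affineGrad_zero : affineGrad (0 : Pt d →ᵃ[ℝ] ℝ) = 0 := by
  refine ext_inner_right ℝ fun v => ?_
  simp [inner_affineGrad]

theorem affineGrad_sub (g g' : Pt d →ᵃ[ℝ] ℝ) :
    affineGrad (g - g') = affineGrad g - affineGrad g' := by
  refine ext_inner_right ℝ fun v => ?_
  simp [inner_sub_left, inner_affineGrad]

theorem continuous_affine (g : Pt d →ᵃ[ℝ] ℝ) : Continuous g :=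
  g.continuous_of_finiteDimensional

theorem affine_sub_smul (g : Pt d →ᵃ[ℝ] ℝ) (x v : Pt d) (s : ℝ) :
    g (x - s • v) = g x - s * g.linear v := by
  have := g.map_vadd x (-(s • v))
  simp only [vadd_eq_add, map_neg, map_smul, smul_eq_mul] at this
  rw [← neg_add_eq_sub, this]; ring

theorem affine_sub_eq (g : Pt d →ᵃ[ℝ] ℝ) (x y : Pt d) :
    g x - g y = inner ℝ (affineGrad g) (x - y) := by
  rw [inner_affineGrad]
  simpa using (g.linearMap_vsub x y).symm

theorem hasGradientAt_affine (g : Pt d →ᵃ[ℝ] ℝ) (x : Pt d) :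
    HasGradientAt g (affineGrad g) x := by
  rw [hasGradientAt_iff_hasFDerivAt]
  have h : ⇑g = fun y => inner ℝ (affineGrad g) y + g 0 := by
    funext y
    have := affine_sub_eq g y 0
    rw [sub_zero] at this
    rw [← this]; ring
  have h2 := ((InnerProductSpace.toDual ℝ (Pt d) (affineGrad g)).hasFDerivAt (x := x)).add_const (g 0)
  rw [h]
  exact h2

theorem gradient_of_eqOn {f : Pt d → ℝ} {g : Pt d →ᵃ[ℝ] ℝ} {U : Set (Pt d)} (hU : IsOpen U)
    (h : Set.EqOn f g U) {x : Pt d} (hx : x ∈ U) : gradient f x = affineGrad g := by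
  have : f =ᶠ[nhds x] g := Filter.eventuallyEq_of_mem (hU.mem_nhds hx) h
  rw [this.gradient.eq_of_nhds]
  exact (hasGradientAt_affine g x).gradient

/-- The prism over a base in the hyperplane `g = 0` with edges `t v`, `0 < t < 1`. -/
def prism (g : Pt d →ᵃ[ℝ] ℝ) (v : Pt d) (E : Set (Pt d)) : Set (Pt d) :=
  {x | (0 < g x ∧ g x < 1) ∧ x - g x • v ∈ E}

theorem measurableSet_prism (g : Pt d →ᵃ[ℝ] ℝ) (v : Pt d) {E : Set (Pt d)}
    (hE : MeasurableSet E) : MeasurableSet (prism g v E) := by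
  have hg := (continuous_affine g)
  refine MeasurableSet.inter (MeasurableSet.inter ?_ ?_) ?_
  · exact measurableSet_lt measurable_const hg.measurable
  · exact measurableSet_lt hg.measurable measurable_const
  · exact (by fun_prop : Continuous fun x => x - g x • v).measurable hE

/-- Cavalieri's principle: the slice of the prism at `g = t` is the translate of `E` by `t v`, and
the slices `0 < t < 1` fill a slab of thickness `1 / ‖∇g‖`. This converts surface measures into
volumes, which behave well under affine maps. -/
theorem norm_mul_volume_prism (g : Pt d →ᵃ[ℝ] ℝ) (v : Pt d) (hv : g.linear v = 1)
    {E : Set (Pt d)} (hE : MeasurableSet E) (hE0 : ∀ x ∈ E, g x = 0) :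
    μHE[d - 1] E = ‖affineGrad g‖ₑ * volume (prism g v E) := by
  set G := affineGrad g with hG
  have hG0 : G ≠ 0 := by
    intro h
    have := inner_affineGrad g v
    rw [← hG, h, inner_zero_left, hv] at this
    norm_num at this
  have hn : 0 < ‖G‖ := norm_pos_iff.2 hG0
  -- The foot of the perpendicular from the origin to the hyperplane `g = 0`.
  set p : Pt d := -(g 0 / ‖G‖ ^ 2) • G with hp
  have hgp : ∀ y, g y = inner ℝ G (y - p) := by
    intro y
    have h1 := affine_sub_eq g y 0
    rw [sub_zero, ← hG] at h1
    rw [inner_sub_right, ← h1, hp, inner_smul_right, real_inner_self_eq_norm_sq]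
    field_simp
    ring
  have key := EuclideanGeometry.euclideanHausdorffMeasure_eq_lintegral p hG0
    (measurableSet_prism g v hE)
  simp only [finrank_euclideanSpace, Fintype.card_fin,
    EuclideanSpace.euclideanHausdorffMeasure_eq_volume] at key
  -- The hyperplane through `p + x • G` orthogonal to `G` is `g = x ‖G‖²`; it meets the slab exactly
  -- for `0 < x < 1 / ‖G‖²`.
  have hsec : ∀ x : ℝ, μHE[d - 1] (prism g v E ∩
      (AffineSubspace.mk' (x • G +ᵥ p) (ℝ ∙ G)ᗮ : AffineSubspace ℝ (Pt d)) : Set (Pt d)) =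
      (Set.Ioo 0 (1 / ‖G‖ ^ 2)).indicator (fun _ => μHE[d - 1] E) x := by
    intro x
    have hmem : ∀ y, y ∈ (AffineSubspace.mk' (x • G +ᵥ p) (ℝ ∙ G)ᗮ : AffineSubspace ℝ (Pt d)) ↔
        g y = x * ‖G‖ ^ 2 := by
      intro y
      rw [AffineSubspace.mem_mk', Submodule.mem_orthogonal_singleton_iff_inner_right, hgp,
        vsub_eq_sub, vadd_eq_add, show y - (x • G + p) = (y - p) - x • G by abel,
        inner_sub_right, inner_smul_right, real_inner_self_eq_norm_sq, sub_eq_zero]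
    by_cases hx : x ∈ Set.Ioo 0 (1 / ‖G‖ ^ 2)
    · rw [Set.indicator_of_mem hx]
      have hx' : 0 < x * ‖G‖ ^ 2 ∧ x * ‖G‖ ^ 2 < 1 :=
        ⟨mul_pos hx.1 (by positivity), (lt_div_iff₀ (by positivity)).1 hx.2⟩
      rw [← measure_preimage_add_right _ (-((x * ‖G‖ ^ 2) • v)) E]
      congr 1
      ext y
      simp only [Set.mem_inter_iff, prism, SetLike.mem_coe, hmem, Set.mem_ofPred_eq,
        Set.mem_preimage, ← sub_eq_add_neg]
      constructor
      · rintro ⟨⟨-, h⟩, h2⟩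
        rwa [h2] at h
      · intro h
        have h2 : g y = x * ‖G‖ ^ 2 := by
          have := hE0 _ h
          rw [affine_sub_smul, hv] at this
          linarith
        rw [h2]
        exact ⟨⟨hx', h⟩, rfl⟩
    · rw [Set.indicator_of_notMem hx]
      convert measure_empty (μ := (μHE[d - 1] : Measure (Pt d)))
      rw [Set.eq_empty_iff_forall_notMem]
      rintro y ⟨⟨h1, -⟩, h2⟩
      rw [SetLike.mem_coe, hmem] at h2
      rw [h2] at h1
      refine hx ⟨?_, ?_⟩
      · by_contra h
        nlinarith [h1.1, sq_nonneg ‖G‖]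
      · rw [lt_div_iff₀ (by positivity)]; exact h1.2
  simp only [hsec] at key
  rw [lintegral_indicator measurableSet_Ioo, setLIntegral_const, Real.volume_Ioo] at key
  rw [key, ← ofReal_norm, ← mul_assoc, ← mul_assoc, mul_comm _ (μHE[d - 1] E), mul_assoc,
    mul_assoc, ← ENNReal.ofReal_mul (by positivity), ← ENNReal.ofReal_mul (by positivity),
    show ‖G‖ * (‖G‖ * (1 / ‖G‖ ^ 2 - 0)) = 1 by field_simp; ring]
  simp

theorem volume_affine_eq_const {g : Pt d →ᵃ[ℝ] ℝ} {v : Pt d} (hv : g.linear v ≠ 0) (c : ℝ) :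
    volume {x | g x = c} = 0 := by
  set s : AffineSubspace ℝ (Pt d) := (AffineSubspace.mk' c ⊥).comap g with hs
  have h : {x | g x = c} = (s : Set (Pt d)) := by
    ext x; simp [hs, sub_eq_zero]
  rw [h]
  refine Measure.addHaar_affineSubspace _ _ fun htop => hv ?_
  have h1 : ∀ x, g x = c := fun x => by
    have : x ∈ (s : Set (Pt d)) := by rw [htop]; trivial
    rwa [← h] at this
  have h2 := affine_sub_smul g 0 v (-1)
  rw [h1, h1] at h2
  linarith

/-- A subset of two transversal hyperplanes has zero surface measure. -/
theorem surface_null (g f : Pt d →ᵃ[ℝ] ℝ) {v w : Pt d} (hv : g.linear v = 1) (hfv : f.linear v = 0)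
    (hw : f.linear w ≠ 0) : μHE[d - 1] {x | g x = 0 ∧ f x = 0} = 0 := by
  rw [norm_mul_volume_prism g v hv]
  -- Since `f` is constant along `v`, the whole prism stays in the hyperplane `f = 0`.
  · have : volume (prism g v {x | g x = 0 ∧ f x = 0}) = 0 := by
      refine measure_mono_null ?_ (volume_affine_eq_const hw 0)
      rintro x ⟨-, -, hx⟩
      rwa [affine_sub_smul, hfv, mul_zero, sub_zero] at hx
    rw [this, mul_zero]
  · exact ((isClosed_eq (continuous_affine g) continuous_const).inter
      (isClosed_eq (continuous_affine f) continuous_const)).measurableSet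
  · exact fun x hx => hx.1

variable {ι : Type*} [Fintype ι]

/-- The affine map sending `b` to `b'` preserves barycentric coordinates and multiplies volume by a
fixed determinant. Hence ratios of volumes of sets given by barycentric inequalities are the same
for all simplices. -/
theorem exists_affine_transport (b b' : AffineBasis ι ℝ (Pt d)) :
    ∃ C : ℝ≥0∞, C ≠ 0 ∧ C ≠ ⊤ ∧ ∀ D : Set (ι → ℝ),
      volume {x | b'.coords x ∈ D} = C * volume {x | b.coords x ∈ D} := by
  classical
  obtain ⟨i₀⟩ := b.nonempty
  set L : Pt d ≃ₗ[ℝ] Pt d := (b.basisOf i₀).equiv (b'.basisOf i₀) (Equiv.refl _) with hL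
  set φ : Pt d → Pt d := fun x => L (x - b i₀) + b' i₀ with hφ
  have hφb : ∀ x, b'.coords (φ x) = b.coords x := by
    intro x
    set f : Pt d →ᵃ[ℝ] Pt d := L.toLinearMap.toAffineMap.comp (AffineMap.id ℝ (Pt d) -
      AffineMap.const ℝ (Pt d) (b i₀)) + AffineMap.const ℝ (Pt d) (b' i₀) with hf
    have hfφ : ∀ y, f y = φ y := fun y => by simp [hf, hφ]
    have hfb : ∀ i, f (b i) = b' i := by
      intro i
      rw [hfφ, hφ]
      by_cases hi : i = i₀
      · simp [hi]
      · have h1 : b i - b i₀ = b.basisOf i₀ ⟨i, hi⟩ := by simp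
        simp only
        rw [h1, hL, Module.Basis.equiv_apply]
        simp
    have h1 : φ x = Finset.univ.affineCombination ℝ b' (fun i => b.coord i x) := by
      rw [← hfφ]
      conv_lhs => rw [← b.affineCombination_coord_eq_self x]
      rw [Finset.map_affineCombination _ _ _ (b.sum_coord_apply_eq_one x)]
      rw [show ⇑f ∘ ⇑b = b' from funext hfb]
    funext i
    rw [h1, AffineBasis.coords_apply, AffineBasis.coord_apply_combination_of_mem _
      (Finset.mem_univ i) (b.sum_coord_apply_eq_one x), AffineBasis.coords_apply]
  refine ⟨ENNReal.ofReal |LinearMap.det L.toLinearMap|, ?_, ENNReal.ofReal_ne_top, fun D => ?_⟩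
  · simpa using L.isUnit_det'.ne_zero
  · have h2 : {x | b'.coords x ∈ D} =
        (fun y => y + b' i₀) '' (L.toLinearMap '' ((fun y => y - b i₀) '' {x | b.coords x ∈ D})) := by
      ext y
      simp only [Set.mem_image, exists_exists_and_eq_and, Set.mem_ofPred_eq]
      constructor
      · intro hy
        refine ⟨L.symm (y - b' i₀) + b i₀, ?_, by simp⟩
        rw [← hφb]
        simpa [hφ] using hy
      · rintro ⟨x, hx, rfl⟩
        rw [← hφb] at hx
        exact hx
    rw [h2]
    simp only [Set.image_add_right, measure_preimage_add_right, Measure.addHaar_image_linearMap,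
      sub_eq_add_neg]

end

/-! ### Pieces of a simplex cut out by barycentric inequalities, and their volumes -/

section

set_option linter.unusedSectionVars false

variable {d : ℕ} {ι : Type*} [Fintype ι]

/-- The part of the interior of a simplex where the barycentric coordinates `i` and `j` agree and
dominate all others. -/
def facet (b : AffineBasis ι ℝ (Pt d)) (i j : ι) : Set (Pt d) :=
  {x | (∀ k, 0 < b.coord k x) ∧ b.coord i x = b.coord j x ∧
    ∀ k, k ≠ i → k ≠ j → b.coord k x < b.coord i x}

/-- The part of the interior of a simplex where the barycentric coordinate `i` dominates all
others. -/
def openCorner (b : AffineBasis ι ℝ (Pt d)) (i : ι) : Set (Pt d) :=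
  {x | (∀ k, 0 < b.coord k x) ∧ ∀ k, k ≠ i → b.coord k x < b.coord i x}

theorem facet_comm (b : AffineBasis ι ℝ (Pt d)) (i j : ι) : facet b i j = facet b j i := by
  ext x
  constructor
  · rintro ⟨h1, h2, h3⟩
    exact ⟨h1, h2.symm, fun k hk hk' => h2 ▸ h3 k hk' hk⟩
  · rintro ⟨h1, h2, h3⟩
    exact ⟨h1, h2.symm, fun k hk hk' => h2 ▸ h3 k hk' hk⟩

theorem measurableSet_facet (b : AffineBasis ι ℝ (Pt d)) (i j : ι) :
    MeasurableSet (facet b i j) := by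
  have hm : ∀ k, Measurable fun x => b.coord k x := fun k =>
    (continuous_affine (b.coord k)).measurable
  have : facet b i j = (⋂ k, {x | 0 < b.coord k x}) ∩ ({x | b.coord i x = b.coord j x} ∩
      ⋂ k, ⋂ (_ : k ≠ i), ⋂ (_ : k ≠ j), {x | b.coord k x < b.coord i x}) := by
    ext; simp [facet]
  rw [this]
  exact (MeasurableSet.iInter fun k => measurableSet_lt measurable_const (hm k)).inter
    ((measurableSet_eq_fun (hm i) (hm j)).inter (MeasurableSet.iInter fun k =>
      MeasurableSet.iInter fun _ => MeasurableSet.iInter fun _ =>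
        measurableSet_lt (hm k) (hm i)))

theorem isOpen_openCorner (b : AffineBasis ι ℝ (Pt d)) (i : ι) : IsOpen (openCorner b i) := by
  have hm : ∀ k, Continuous fun x => b.coord k x := fun k => continuous_affine (b.coord k)
  have : openCorner b i = (⋂ k, {x | 0 < b.coord k x}) ∩
      ⋂ k, ⋂ (_ : k ≠ i), {x | b.coord k x < b.coord i x} := by
    ext; simp [openCorner]
  rw [this]
  exact (isOpen_iInter_of_finite fun k => isOpen_lt continuous_const (hm k)).inter
    (isOpen_iInter_of_finite fun k => isOpen_iInter_of_finite fun _ => isOpen_lt (hm k) (hm i))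

theorem coord_linear_sub [DecidableEq ι] (b : AffineBasis ι ℝ (Pt d)) (i j k : ι) :
    (b.coord k).linear (b j - b i) = (if k = j then 1 else 0) - (if k = i then 1 else 0) := by
  have := (b.coord k).linearMap_vsub (b j) (b i)
  simp only [vsub_eq_sub] at this
  rw [this, b.coord_apply, b.coord_apply]

theorem affine_eq_sum_coord (b : AffineBasis ι ℝ (Pt d)) (g : Pt d →ᵃ[ℝ] ℝ) (x : Pt d) :
    g x = ∑ i, b.coord i x * g (b i) := by
  conv_lhs => rw [← b.affineCombination_coord_eq_self x]
  rw [Finset.map_affineCombination _ _ _ (b.sum_coord_apply_eq_one x),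
    Finset.affineCombination_eq_linear_combination _ _ _ (b.sum_coord_apply_eq_one x)]
  simp

theorem sum_affineGrad_coord (b : AffineBasis ι ℝ (Pt d)) :
    ∑ i, affineGrad (b.coord i) = 0 := by
  refine ext_inner_right ℝ fun v => ?_
  rw [sum_inner, inner_zero_left]
  have h : ∀ i, inner ℝ (affineGrad (b.coord i)) v = b.coord i v - b.coord i 0 := fun i => by
    rw [affine_sub_eq, sub_zero]
  simp [h, b.sum_coord_apply_eq_one]

theorem affineGrad_eq_sum (b : AffineBasis ι ℝ (Pt d)) (g : Pt d →ᵃ[ℝ] ℝ) :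
    affineGrad g = ∑ i, g (b i) • affineGrad (b.coord i) := by
  refine ext_inner_right ℝ fun v => ?_
  have h : ∀ f : Pt d →ᵃ[ℝ] ℝ, inner ℝ (affineGrad f) v = f v - f 0 := fun f => by
    rw [affine_sub_eq, sub_zero]
  simp only [sum_inner, inner_smul_left, h]
  rw [affine_eq_sum_coord b g v, affine_eq_sum_coord b g 0, ← Finset.sum_sub_distrib]
  exact Finset.sum_congr rfl fun i _ => by simp; ring

/-- The barycentric coordinates of the points of the prism over a facet. -/
def prismCoords (i j : ι) : Set (ι → ℝ) :=
  {l | (0 < l j - l i ∧ l j - l i < 1) ∧ 0 < l i + l j ∧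
    ∀ k, k ≠ i → k ≠ j → 0 < l k ∧ 2 * l k < l i + l j}

/-- A shift along `(b j - b i) / 2` preserves `λ_i + λ_j` and all other coordinates, and raises `λ_j
- λ_i` at unit rate. So the common value of `λ_i` and `λ_j` at the base point is `(λ_i + λ_j) / 2`.
-/
theorem prism_facet_eq (b : AffineBasis ι ℝ (Pt d)) {i j : ι} (hij : i ≠ j) :
    prism (b.coord j - b.coord i) ((1 / 2 : ℝ) • (b j - b i)) (facet b i j) =
      {x | b.coords x ∈ prismCoords i j} := by
  classical
  ext x
  have hg : (b.coord j - b.coord i) x = b.coord j x - b.coord i x := rfl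
  have hsh : ∀ k, b.coord k (x - (b.coord j - b.coord i) x • (1 / 2 : ℝ) • (b j - b i)) =
      b.coord k x - (b.coord j x - b.coord i x) * (1 / 2) *
        ((if k = j then 1 else 0) - (if k = i then 1 else 0)) := by
    intro k
    rw [affine_sub_smul, map_smul, coord_linear_sub, hg, smul_eq_mul]; ring
  simp only [prism, facet, prismCoords, Set.mem_ofPred_eq, hsh, AffineBasis.coords_apply]
  rw [hg]
  refine and_congr_right fun _ => ?_
  constructor
  · rintro ⟨h1, h2, h3⟩
    refine ⟨?_, fun k hki hkj => ?_⟩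
    · have := h1 i; simp [hij] at this; linarith
    · have h4 := h1 k
      have h5 := h3 k hki hkj
      simp [hki, hkj, hij] at h4 h5
      exact ⟨h4, by linarith⟩
  · rintro ⟨h1, h2⟩
    refine ⟨fun k => ?_, ?_, fun k hki hkj => ?_⟩
    · by_cases hki : k = i
      · subst hki; simp [hij]; linarith
      · by_cases hkj : k = j
        · subst hkj; simp [hij.symm]; linarith
        · have := (h2 k hki hkj).1
          simp [hki, hkj]; linarith
    · simp [hij, hij.symm]; ring
    · have := (h2 k hki hkj).2
      simp [hki, hkj, hij]; linarith

theorem mem_prismCoords_reindex {ι' : Type*} (e : ι ≃ ι') (i j : ι) (l : ι' → ℝ) :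
    (fun k => l (e k)) ∈ prismCoords i j ↔ l ∈ prismCoords (e i) (e j) := by
  simp only [prismCoords, Set.mem_ofPred_eq]
  refine and_congr_right fun _ => and_congr_right fun _ => ?_
  constructor
  · intro h k hk hk'
    have := h (e.symm k) (by rwa [Ne, Equiv.symm_apply_eq]) (by rwa [Ne, Equiv.symm_apply_eq])
    simpa using this
  · intro h k hk hk'
    exact h (e k) (by simpa) (by simpa)

/-- The barycentric coordinates of the points of an open corner. -/
def cornerCoords (i : ι) : Set (ι → ℝ) :=
  {l | (∀ k, 0 < l k) ∧ ∀ k, k ≠ i → l k < l i}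

theorem mem_cornerCoords_reindex {ι' : Type*} (e : ι ≃ ι') (i : ι) (l : ι' → ℝ) :
    (fun k => l (e k)) ∈ cornerCoords i ↔ l ∈ cornerCoords (e i) := by
  simp only [cornerCoords, Set.mem_ofPred_eq]
  constructor
  · rintro ⟨h1, h2⟩
    refine ⟨fun k => by simpa using h1 (e.symm k), fun k hk => ?_⟩
    simpa using h2 (e.symm k) (by rwa [Ne, Equiv.symm_apply_eq])
  · rintro ⟨h1, h2⟩
    exact ⟨fun k => h1 _, fun k hk => h2 (e k) (by simpa)⟩

theorem exists_coords_eq (b : AffineBasis ι ℝ (Pt d)) {l : ι → ℝ} (hl : ∑ i, l i = 1) :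
    ∃ x, b.coords x = l := by
  refine ⟨Finset.univ.affineCombination ℝ b l, funext fun i => ?_⟩
  rw [AffineBasis.coords_apply, b.coord_apply_combination_of_mem (Finset.mem_univ i) hl]

theorem volume_coords_lt_top (b : AffineBasis ι ℝ (Pt d)) {D : Set (ι → ℝ)}
    (hD : ∀ l ∈ D, ∑ i, l i = 1 → ∀ i, |l i| ≤ 1) : volume {x | b.coords x ∈ D} < ⊤ := by
  refine lt_of_le_of_lt (measure_mono (t := Metric.closedBall 0 (∑ i, ‖b i‖)) fun x hx => ?_)
    (isCompact_closedBall _ _).measure_lt_top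
  have h1 := hD _ hx (b.sum_coord_apply_eq_one x)
  rw [mem_closedBall_zero_iff, ← b.linear_combination_coord_eq_self x]
  refine (norm_sum_le _ _).trans (Finset.sum_le_sum fun i _ => ?_)
  rw [norm_smul, Real.norm_eq_abs]
  exact mul_le_of_le_one_left (norm_nonneg _) (h1 i)

theorem simplex_eq (b : AffineBasis ι ℝ (Pt d)) :
    convexHull ℝ (Set.range b) = {x | ∀ k, 0 ≤ b.coord k x} :=
  b.convexHull_eq_nonneg_coord

theorem volume_prismCoords_pos (b : AffineBasis ι ℝ (Pt d)) {i j : ι} (hij : i ≠ j) :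
    0 < volume {x | b.coords x ∈ prismCoords i j} := by
  classical
  refine IsOpen.measure_pos _ ?_ ?_
  · have hm : ∀ k, Continuous fun x => b.coord k x := fun k => continuous_affine (b.coord k)
    have : {x | b.coords x ∈ prismCoords i j} =
        (({x | 0 < b.coord j x - b.coord i x} ∩ {x | b.coord j x - b.coord i x < 1}) ∩
          {x | 0 < b.coord i x + b.coord j x}) ∩
        ⋂ k, ⋂ (_ : k ≠ i), ⋂ (_ : k ≠ j),
          ({x | 0 < b.coord k x} ∩ {x | 2 * b.coord k x < b.coord i x + b.coord j x}) := by
      ext; simp [prismCoords]; tauto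
    rw [this]
    refine (((isOpen_lt continuous_const ((hm j).sub (hm i))).inter
      (isOpen_lt ((hm j).sub (hm i)) continuous_const)).inter
      (isOpen_lt continuous_const ((hm i).add (hm j)))).inter
      (isOpen_iInter_of_finite fun k => isOpen_iInter_of_finite fun _ =>
        isOpen_iInter_of_finite fun _ => (isOpen_lt continuous_const (hm k)).inter
          (isOpen_lt ((hm k).const_mul 2) ((hm i).add (hm j))))
  · set N : ℝ := ((Fintype.card ι : ℕ) : ℝ) with hNdef
    have hN : 0 ≤ N := Nat.cast_nonneg _
    -- Weights `3/2` at `i`, `5/2` at `j` and `1` elsewhere: `j` exceeds `i`, and their mean `2`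
    -- exceeds the rest. The total is `N + 2`.
    obtain ⟨x, hx⟩ := exists_coords_eq b (l := fun k => (1 + (if k = i then 1 / 2 else 0) +
      (if k = j then 3 / 2 else 0)) / (N + 2)) (by
        rw [← Finset.sum_div, div_eq_one_iff_eq (by positivity), Finset.sum_add_distrib,
          Finset.sum_add_distrib, Finset.sum_ite_eq', Finset.sum_ite_eq']
        simp [hNdef]; ring)
    refine ⟨x, ?_⟩
    rw [Set.mem_ofPred_eq, hx]
    have h2 : 0 < N + 2 := by positivity
    refine ⟨⟨?_, ?_⟩, ?_, fun k hki hkj => ⟨?_, ?_⟩⟩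
    · simp only [hij, hij.symm, if_true, if_false]
      rw [← sub_div]
      refine div_pos (by norm_num) h2
    · simp only [hij, hij.symm, if_true, if_false]
      rw [← sub_div, div_lt_one h2]; linarith
    · simp only [hij, hij.symm, if_true, if_false]
      positivity
    · simp only [hki, hkj, if_false]; positivity
    · simp only [hki, hkj, hij, hij.symm, if_true, if_false]
      rw [← add_div, ← mul_div_assoc, div_lt_div_iff_of_pos_right h2]; norm_num

theorem volume_cornerCoords_pos (b : AffineBasis ι ℝ (Pt d)) (i : ι) :
    0 < volume {x | b.coords x ∈ cornerCoords i} := by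
  classical
  refine IsOpen.measure_pos _ (isOpen_openCorner b i) ?_
  set N : ℝ := ((Fintype.card ι : ℕ) : ℝ) with hNdef
  have hN : 0 ≤ N := Nat.cast_nonneg _
  obtain ⟨x, hx⟩ := exists_coords_eq b (l := fun k => (1 + (if k = i then 1 else 0)) / (N + 1)) (by
      rw [← Finset.sum_div, div_eq_one_iff_eq (by positivity), Finset.sum_add_distrib,
        Finset.sum_ite_eq']
      simp [hNdef])
  refine ⟨x, ?_⟩
  rw [Set.mem_ofPred_eq, hx]
  refine ⟨fun k => ?_, fun k hk => ?_⟩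
  · dsimp only; split_ifs <;> positivity
  · simp only [hk, if_true, if_false]
    rw [div_lt_div_iff_of_pos_right (by positivity)]; norm_num

theorem volume_simplex_pos (b : AffineBasis ι ℝ (Pt d)) :
    0 < volume (convexHull ℝ (Set.range b)) := by
  obtain ⟨i⟩ := b.nonempty
  refine (volume_cornerCoords_pos b i).trans_le (measure_mono fun x hx => ?_)
  rw [simplex_eq]
  exact fun k => (hx.1 k).le

theorem volume_simplex_lt_top (b : AffineBasis ι ℝ (Pt d)) :
    volume (convexHull ℝ (Set.range b)) < ⊤ :=
  (Set.finite_range b).isCompact_convexHull ℝ |>.measure_lt_top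

/-- The coordinate `i` may be negative on the prism, which can thus leave the simplex; finiteness of
its volume needs this separate bound. -/
theorem abs_le_of_mem_prismCoords {i j : ι} (hij : i ≠ j) {l : ι → ℝ} (h : l ∈ prismCoords i j)
    (hl : ∑ k, l k = 1) (k : ι) : |l k| ≤ 1 := by
  classical
  obtain ⟨⟨h1, h2⟩, h3, h4⟩ := h
  have h5 : l i + l j ≤ 1 := by
    rw [← hl, ← Finset.sum_pair hij]
    refine Finset.sum_le_sum_of_subset_of_nonneg (Finset.subset_univ _) fun k _ hk => ?_
    simp only [Finset.mem_insert, Finset.mem_singleton, not_or] at hk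
    exact (h4 k hk.1 hk.2).1.le
  rw [abs_le]
  by_cases hki : k = i
  · subst hki; constructor <;> linarith
  · by_cases hkj : k = j
    · subst hkj; constructor <;> linarith
    · have := h4 k hki hkj
      constructor <;> linarith

theorem exists_equiv_fin (i j : ι) (hij : i ≠ j) {n : ℕ} (hn : Fintype.card ι = n) (i₀ j₀ : Fin n)
    (h₀ : i₀ ≠ j₀) : ∃ e : ι ≃ Fin n, e i = i₀ ∧ e j = j₀ := by
  classical
  set e := Fintype.equivFinOfCardEq hn
  set e₁ := e.trans (Equiv.swap (e i) i₀) with he₁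
  have h1 : e₁ i = i₀ := by simp [he₁]
  refine ⟨e₁.trans (Equiv.swap (e₁ j) j₀), ?_, by simp⟩
  rw [Equiv.trans_apply, h1]
  refine Equiv.swap_apply_of_ne_of_ne (fun h => hij ?_) h₀
  exact e₁.injective (h1.trans h)

/-- The prisms over the facets, and the open corners, fill a fixed fraction of a simplex. -/
theorem exists_volume_constants (hd : 1 ≤ d) : ∃ m > (0 : ℝ), ∃ τ > (0 : ℝ),
    ∀ (ι : Type) [Fintype ι] (b : AffineBasis ι ℝ (Pt d)),
      (∀ i j, i ≠ j → volume (prism (b.coord j - b.coord i) ((1 / 2 : ℝ) • (b j - b i))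
        (facet b i j)) = ENNReal.ofReal (m * volume.real (convexHull ℝ (Set.range b)))) ∧
      ∀ i, volume.real (openCorner b i) = τ * volume.real (convexHull ℝ (Set.range b)) := by
  -- One reference simplex with one pair of vertices suffices: relabelling carries any pair to `i₀`,
  -- `j₀`, and affine transport does the rest.
  obtain ⟨b₀⟩ := AffineBasis.exists_affineBasis_of_finiteDimensional (ι := Fin (d + 1)) (k := ℝ)
    (P := Pt d) (by simp)
  set i₀ : Fin (d + 1) := ⟨0, by omega⟩
  set j₀ : Fin (d + 1) := ⟨1, by omega⟩
  have h₀ : i₀ ≠ j₀ := by simp [i₀, j₀]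
  set VS := volume.real (convexHull ℝ (Set.range b₀)) with hVS
  set VP := volume.real {x | b₀.coords x ∈ prismCoords i₀ j₀} with hVP
  set VC := volume.real {x | b₀.coords x ∈ cornerCoords i₀} with hVC
  have hPtop : volume {x | b₀.coords x ∈ prismCoords i₀ j₀} < ⊤ :=
    volume_coords_lt_top b₀ fun l hl hs => abs_le_of_mem_prismCoords h₀ hl hs
  have hCle : ∀ {ι : Type} [Fintype ι] (b : AffineBasis ι ℝ (Pt d)) (i : ι),
      volume (openCorner b i) < ⊤ := fun b i =>
    lt_of_le_of_lt (measure_mono fun x hx => by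
      rw [simplex_eq]; exact fun k => (hx.1 k).le) (volume_simplex_lt_top b)
  have hVSpos : 0 < VS := ENNReal.toReal_pos (volume_simplex_pos b₀).ne' (volume_simplex_lt_top b₀).ne
  have hVPpos : 0 < VP := ENNReal.toReal_pos (volume_prismCoords_pos b₀ h₀).ne' hPtop.ne
  have hVCpos : 0 < VC := ENNReal.toReal_pos (volume_cornerCoords_pos b₀ i₀).ne' (hCle b₀ i₀).ne
  have hsimp : ∀ {ι : Type} [Fintype ι] (b : AffineBasis ι ℝ (Pt d)),
      convexHull ℝ (Set.range b) = {x | b.coords x ∈ {l : ι → ℝ | ∀ k, 0 ≤ l k}} := fun b => by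
    rw [simplex_eq]; rfl
  refine ⟨VP / VS, by positivity, VC / VS, by positivity, fun ι _ b => ⟨fun i j hij => ?_,
    fun i => ?_⟩⟩
  · have hcard : Fintype.card ι = d + 1 := by
      have := b.card_eq_finrank_add_one; simpa using this
    obtain ⟨e, he1, he2⟩ := exists_equiv_fin i j hij hcard i₀ j₀ h₀
    obtain ⟨C, hC0, hCt, hC⟩ := exists_affine_transport b₀ (b.reindex e)
    rw [prism_facet_eq b hij]
    have h1 : {x | b.coords x ∈ prismCoords i j} =
        {x | (b.reindex e).coords x ∈ prismCoords i₀ j₀} := by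
      ext x
      rw [Set.mem_ofPred_eq, Set.mem_ofPred_eq, ← he1, ← he2, ← mem_prismCoords_reindex]
      simp [AffineBasis.coords]
    have h2 : volume (convexHull ℝ (Set.range b)) = C * volume (convexHull ℝ (Set.range b₀)) := by
      rw [hsimp b₀, ← hC, ← hsimp]
      simp
    rw [h1, hC, measureReal_def, h2, ENNReal.toReal_mul, ← measureReal_def, ← hVS,
      show VP / VS * (C.toReal * VS) = C.toReal * VP by field_simp,
      ENNReal.ofReal_mul ENNReal.toReal_nonneg, ENNReal.ofReal_toReal hCt, hVP, measureReal_def,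
      ENNReal.ofReal_toReal hPtop.ne]
  · have hcard : Fintype.card ι = d + 1 := by
      have := b.card_eq_finrank_add_one; simpa using this
    have : Nontrivial ι := Fintype.one_lt_card_iff_nontrivial.1 (by omega)
    obtain ⟨j, hij⟩ := exists_ne i
    obtain ⟨e, he1, -⟩ := exists_equiv_fin i j hij.symm hcard i₀ j₀ h₀
    obtain ⟨C, hC0, hCt, hC⟩ := exists_affine_transport b₀ (b.reindex e)
    have h1 : openCorner b i =
        {x | (b.reindex e).coords x ∈ cornerCoords i₀} := by
      ext x
      rw [Set.mem_ofPred_eq, ← he1, ← mem_cornerCoords_reindex]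
      simp [openCorner, cornerCoords]
    have h2 : volume (convexHull ℝ (Set.range b)) = C * volume (convexHull ℝ (Set.range b₀)) := by
      rw [hsimp b₀, ← hC, ← hsimp]
      simp
    rw [h1, measureReal_def, measureReal_def, hC, h2, ENNReal.toReal_mul, ENNReal.toReal_mul,
      ← measureReal_def, ← measureReal_def, ← hVS, ← hVC]
    field_simp

end

/-! ### Discrete flux balance on one simplex, and shape regularity -/

section

set_option linter.unusedSectionVars false

variable {d : ℕ} {ι : Type} [Fintype ι]

/-- The unit normal of `facet b i j`, pointing from the corner of `i` to the corner of `j`. -/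
def facetNormal (b : AffineBasis ι ℝ (Pt d)) (i j : ι) : Pt d :=
  ‖affineGrad (b.coord j - b.coord i)‖⁻¹ • affineGrad (b.coord j - b.coord i)

theorem facetNormal_comm (b : AffineBasis ι ℝ (Pt d)) (i j : ι) :
    facetNormal b j i = -facetNormal b i j := by
  simp only [facetNormal, affineGrad_sub]
  rw [norm_sub_rev, ← smul_neg, neg_sub]

/-- Makes diagonal flux terms vanish, so that sums may run over all pairs of vertices. -/
theorem facetNormal_self (b : AffineBasis ι ℝ (Pt d)) (i : ι) : facetNormal b i i = 0 := by
  simp [facetNormal]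

theorem norm_facetNormal_le (b : AffineBasis ι ℝ (Pt d)) (i j : ι) : ‖facetNormal b i j‖ ≤ 1 := by
  rw [facetNormal, norm_smul, norm_inv, norm_norm]
  exact inv_mul_le_one

theorem linear_half_edge (b : AffineBasis ι ℝ (Pt d)) {i j : ι} (hij : i ≠ j) :
    (b.coord j - b.coord i).linear ((1 / 2 : ℝ) • (b j - b i)) = 1 := by
  classical
  rw [AffineMap.sub_linear, LinearMap.sub_apply, map_smul, map_smul, coord_linear_sub,
    coord_linear_sub]
  simp [hij, hij.symm]
  norm_num

theorem affineGrad_coord_sub_ne_zero (b : AffineBasis ι ℝ (Pt d)) {i j : ι} (hij : i ≠ j) :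
    affineGrad (b.coord j - b.coord i) ≠ 0 := by
  intro h
  have h1 := inner_affineGrad (b.coord j - b.coord i) ((1 / 2 : ℝ) • (b j - b i))
  rw [h, linear_half_edge b hij, inner_zero_left] at h1
  norm_num at h1

/-- `m` is the ratio of `|facet| / |∇(λ_j - λ_i)|` and the volume of the simplex. -/
def IsFacetConstant (d : ℕ) (m : ℝ) : Prop :=
  0 < m ∧ ∀ (ι : Type) [Fintype ι] (b : AffineBasis ι ℝ (Pt d)) (i j : ι), i ≠ j →
    μHE[d - 1] (facet b i j) = ENNReal.ofReal (m * volume.real (convexHull ℝ (Set.range b)) *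
      ‖affineGrad (b.coord j - b.coord i)‖)

/-- `τ` is the ratio of the volumes of the open corners and of the simplex. -/
def IsCornerConstant (d : ℕ) (τ : ℝ) : Prop :=
  0 < τ ∧ ∀ (ι : Type) [Fintype ι] (b : AffineBasis ι ℝ (Pt d)) (i : ι),
    volume.real (openCorner b i) = τ * volume.real (convexHull ℝ (Set.range b))

/-- The facet lies in `λ_j - λ_i = 0`, a function that grows by `1` along half the edge from `i` to
`j`. Its area is therefore `‖∇(λ_j - λ_i)‖` times the volume of the prism, a fixed fraction of the
volume of the simplex. -/
theorem exists_facetConstant_cornerConstant (hd : 1 ≤ d) :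
    (∃ m, IsFacetConstant d m) ∧ ∃ τ, IsCornerConstant d τ := by
  obtain ⟨m, hm, τ, hτ, h⟩ := exists_volume_constants hd
  refine ⟨⟨m, hm, fun ι _ b i j hij => ?_⟩, τ, hτ, fun ι _ b i => (h ι b).2 i⟩
  rw [norm_mul_volume_prism _ _ (linear_half_edge b hij) (measurableSet_facet b i j),
    (h ι b).1 i j hij, ← ofReal_norm, ← ENNReal.ofReal_mul (norm_nonneg _), mul_comm ‖_‖]
  intro x hx
  have := hx.2.1
  rw [AffineMap.coe_sub, Pi.sub_apply]
  linarith

/-- Bounds the error in the discrete flux identity, `R` controlling the shape of the simplex. -/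
theorem element_flux_ge {m : ℝ} (hm : IsFacetConstant d m) (b : AffineBasis ι ℝ (Pt d))
    (g : Pt d →ᵃ[ℝ] ℝ) (W : Pt d → Pt d) (w : Pt d) {δ R : ℝ} (hδ : 0 ≤ δ)
    (hR : ∀ i j, ‖b i - b j‖ * ‖affineGrad (b.coord j - b.coord i)‖ ≤ R)
    (hint : ∀ i j, i ≠ j → IntegrableOn W (facet b i j) μHE[d - 1])
    (hW : ∀ x ∈ interior (convexHull ℝ (Set.range b)), ‖W x - w‖ ≤ δ * ‖affineGrad g‖) :
    m * volume.real (convexHull ℝ (Set.range b)) * ((d + 1) * inner ℝ w (affineGrad g) -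
        (d + 1) ^ 2 * R * δ * ‖affineGrad g‖ ^ 2 / 2) ≤
      -∑ i, g (b i) * ∑ j, ∫ x in facet b i j, inner ℝ (W x) (facetNormal b i j) ∂μHE[d - 1] := by
  set V := volume.real (convexHull ℝ (Set.range b)) with hV
  have hV0 : 0 ≤ V := measureReal_nonneg
  obtain ⟨hm0, hm⟩ := hm
  have hcard : Fintype.card ι = d + 1 := by
    have := b.card_eq_finrank_add_one; simpa using this
  set G : ι → ι → Pt d := fun i j => affineGrad (b.coord j - b.coord i) with hG
  have harea : ∀ i j, i ≠ j → (μHE[d - 1] : Measure (Pt d)).real (facet b i j) = m * V * ‖G i j‖ :=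
    fun i j hij => by
      rw [measureReal_def, hm ι b i j hij, ENNReal.toReal_ofReal (by positivity)]
  have hfin : ∀ i j, i ≠ j → μHE[d - 1] (facet b i j) < ⊤ := fun i j hij => by
    rw [hm ι b i j hij]; exact ENNReal.ofReal_lt_top
  set E : ι → ι → ℝ := fun i j =>
    ∫ x in facet b i j, inner ℝ (W x - w) (facetNormal b i j) ∂μHE[d - 1] with hE
  -- Split `W = w + (W - w)`. In the constant part the factor `‖G i j‖` of the area cancels the
  -- normalisation of the normal.
  have hF : ∀ i j, ∫ x in facet b i j, inner ℝ (W x) (facetNormal b i j) ∂μHE[d - 1] =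
      m * V * inner ℝ w (G i j) + E i j := by
    intro i j
    by_cases hij : i = j
    · subst hij
      simp [hE, hG, facetNormal_self, affineGrad_sub]
    · have : Fact ((μHE[d - 1] : Measure (Pt d)) (facet b i j) < ⊤) := ⟨hfin i j hij⟩
      simp only [hE, inner_sub_left]
      rw [integral_sub ((hint i j hij).inner_const _) (integrable_const _), setIntegral_const,
        harea i j hij, facetNormal, inner_smul_right, smul_eq_mul]
      have hne : ‖G i j‖ ≠ 0 := norm_ne_zero_iff.2 (affineGrad_coord_sub_ne_zero b hij)
      have : m * V * ‖G i j‖ * (‖G i j‖⁻¹ * inner ℝ w (G i j)) = m * V * inner ℝ w (G i j) := by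
        field_simp
      simp only [hG] at this ⊢
      rw [this]; ring
  have hEanti : ∀ i j, E j i = -E i j := fun i j => by
    simp only [hE, facetNormal_comm b i j, inner_neg_right, facet_comm b j i, integral_neg]
  have hEbd : ∀ i j, |E i j| ≤ m * V * ‖G i j‖ * (δ * ‖affineGrad g‖) := by
    intro i j
    by_cases hij : i = j
    · subst hij
      simp [hE, hG, facetNormal_self, affineGrad_sub]
    · rw [← harea i j hij, mul_comm, ← Real.norm_eq_abs]
      refine norm_setIntegral_le_of_norm_le_const (hfin i j hij) fun x hx => ?_
      refine (norm_inner_le_norm _ _).trans ?_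
      refine (mul_le_of_le_one_right (norm_nonneg _) (norm_facetNormal_le b i j)).trans (hW x ?_)
      rw [b.interior_convexHull]; exact hx.1
  -- As the gradients of the barycentric coordinates sum to zero, only the `d + 1` copies of `-∇λ_i`
  -- survive; this yields the exact identity for constant fluxes.
  have hGsum : ∀ i, ∑ j, G i j = -((d + 1 : ℝ) • affineGrad (b.coord i)) := fun i => by
    simp only [hG, affineGrad_sub]
    rw [Finset.sum_sub_distrib, sum_affineGrad_coord, Finset.sum_const, Finset.card_univ, hcard,
      zero_sub, ← Nat.cast_smul_eq_nsmul ℝ]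
    push_cast; rfl
  have hmain : ∑ i, g (b i) * ∑ j, m * V * inner ℝ w (G i j) =
      -(m * V * ((d + 1) * inner ℝ w (affineGrad g))) := by
    rw [affineGrad_eq_sum b g, inner_sum, Finset.mul_sum, Finset.mul_sum, ← Finset.sum_neg_distrib]
    refine Finset.sum_congr rfl fun i _ => ?_
    rw [← Finset.mul_sum, ← inner_sum, hGsum, inner_neg_right, inner_smul_right, inner_smul_right]
    ring
  have herr : ∑ i, g (b i) * ∑ j, E i j ≤
      m * V * ((d + 1) ^ 2 * R * δ * ‖affineGrad g‖ ^ 2 / 2) := by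
    -- Antisymmetrisation replaces vertex values by differences, which are of size `‖∇g‖` times an
    -- edge length. That length compensates the gradient in the area of the facet.
    have h1 : ∑ i, g (b i) * ∑ j, E i j = (1 / 2) * ∑ i, ∑ j, (g (b i) - g (b j)) * E i j := by
      have h2 : ∑ i, ∑ j, g (b j) * E i j = -∑ i, ∑ j, g (b i) * E i j := by
        rw [Finset.sum_comm, ← Finset.sum_neg_distrib]
        refine Finset.sum_congr rfl fun i _ => ?_
        rw [← Finset.sum_neg_distrib]
        exact Finset.sum_congr rfl fun j _ => by rw [hEanti]; ring
      simp only [sub_mul, Finset.sum_sub_distrib, h2, Finset.mul_sum]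
      ring
    rw [h1]
    have h3 : ∀ i j, (g (b i) - g (b j)) * E i j ≤ m * V * (R * δ * ‖affineGrad g‖ ^ 2) := by
      intro i j
      refine (le_abs_self _).trans ?_
      rw [abs_mul]
      have h4 : |g (b i) - g (b j)| ≤ ‖affineGrad g‖ * ‖b i - b j‖ := by
        rw [affine_sub_eq]; exact abs_real_inner_le_norm _ _
      calc |g (b i) - g (b j)| * |E i j|
          ≤ (‖affineGrad g‖ * ‖b i - b j‖) * (m * V * ‖G i j‖ * (δ * ‖affineGrad g‖)) :=
            mul_le_mul h4 (hEbd i j) (abs_nonneg _) (by positivity)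
        _ = m * V * ((‖b i - b j‖ * ‖G i j‖) * (δ * ‖affineGrad g‖ ^ 2)) := by ring
        _ ≤ m * V * (R * (δ * ‖affineGrad g‖ ^ 2)) := by
            gcongr
            exact hR i j
        _ = _ := by ring
    have h5 : ∑ i, ∑ j, (g (b i) - g (b j)) * E i j ≤
        ∑ _i : ι, ∑ _j : ι, m * V * (R * δ * ‖affineGrad g‖ ^ 2) :=
      Finset.sum_le_sum fun i _ => Finset.sum_le_sum fun j _ => h3 i j
    simp only [Finset.sum_const, Finset.card_univ, hcard, nsmul_eq_mul] at h5
    push_cast at h5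
    linarith
  have hall : ∑ i, g (b i) * ∑ j, ∫ x in facet b i j, inner ℝ (W x) (facetNormal b i j) ∂μHE[d - 1] =
      ∑ i, g (b i) * ∑ j, m * V * inner ℝ w (G i j) + ∑ i, g (b i) * ∑ j, E i j := by
    rw [← Finset.sum_add_distrib]
    refine Finset.sum_congr rfl fun i _ => ?_
    rw [← mul_add, ← Finset.sum_add_distrib]
    exact congrArg _ (Finset.sum_congr rfl fun j _ => hF i j)
  rw [hall, hmain]
  linarith

/-- A ball contained in a simplex bounds the gradients of the barycentric coordinates. -/
theorem inscribedDiam_mul_norm_grad_le (b : AffineBasis ι ℝ (Pt d)) (i : ι) :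
    inscribedDiam (convexHull ℝ (Set.range b)) * ‖affineGrad (b.coord i)‖ ≤ 1 := by
  set G := affineGrad (b.coord i) with hG
  rcases eq_or_ne G 0 with h0 | h0
  · rw [h0]; simp
  have hn : 0 < ‖G‖ := norm_pos_iff.2 h0
  rw [← le_div_iff₀ hn, inscribedDiam]
  refine Real.sSup_le ?_ (by positivity)
  rintro ρ ⟨x, r, hr, rfl, hx⟩
  rw [le_div_iff₀ hn]
  have hcoord : ∀ y ∈ convexHull ℝ (Set.range b), 0 ≤ b.coord i y ∧ b.coord i y ≤ 1 := by
    intro y hy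
    rw [simplex_eq] at hy
    refine ⟨hy i, ?_⟩
    rw [← b.sum_coord_apply_eq_one y]
    exact Finset.single_le_sum (f := fun k => b.coord k y) (fun k _ => hy k) (Finset.mem_univ i)
  -- Between the two ends of the diameter of the ball in direction `G`, the coordinate grows by `2 r
  -- ‖G‖`, yet it stays in `[0, 1]`.
  have h1 := hcoord _ (hx (show x + (r / ‖G‖) • G ∈ Metric.closedBall x r by
    rw [mem_closedBall_iff_norm, add_sub_cancel_left, norm_smul, norm_div, norm_norm,
      Real.norm_of_nonneg hr, div_mul_cancel₀ _ hn.ne']))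
  have h2 := hcoord _ (hx (show x - (r / ‖G‖) • G ∈ Metric.closedBall x r by
    rw [mem_closedBall_iff_norm, sub_sub_cancel_left, norm_neg, norm_smul, norm_div, norm_norm,
      Real.norm_of_nonneg hr, div_mul_cancel₀ _ hn.ne']))
  have h3 := affine_sub_eq (b.coord i) (x + (r / ‖G‖) • G) (x - (r / ‖G‖) • G)
  rw [← hG, show x + (r / ‖G‖) • G - (x - (r / ‖G‖) • G) = (2 * (r / ‖G‖)) • G by
    rw [mul_smul, two_smul]; abel, inner_smul_right, real_inner_self_eq_norm_sq] at h3
  have h4 : 2 * (r / ‖G‖) * ‖G‖ ^ 2 = 2 * r * ‖G‖ := by field_simp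
  rw [h4] at h3
  linarith [h1.2, h2.1]

/-- An edge is at most the diameter, and the inscribed ball bounds each `‖∇λ_k‖` by `1 / (σ diam
K)`. The product is scale invariant, so the bound does not depend on the mesh size. -/
theorem norm_sub_mul_norm_grad_le {σ : ℝ} (hσ : 0 < σ) (b : AffineBasis ι ℝ (Pt d))
    (h : σ * Metric.diam (convexHull ℝ (Set.range b)) ≤
      inscribedDiam (convexHull ℝ (Set.range b))) (i j : ι) :
    ‖b i - b j‖ * ‖affineGrad (b.coord j - b.coord i)‖ ≤ 2 / σ := by
  have hb : Bornology.IsBounded (convexHull ℝ (Set.range b)) :=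
    ((Set.finite_range b).isCompact_convexHull ℝ).isBounded
  have h1 : ‖b i - b j‖ ≤ Metric.diam (convexHull ℝ (Set.range b)) := by
    rw [← dist_eq_norm]
    exact Metric.dist_le_diam_of_mem hb (subset_convexHull ℝ _ ⟨i, rfl⟩)
      (subset_convexHull ℝ _ ⟨j, rfl⟩)
  have h2 : ∀ k, Metric.diam (convexHull ℝ (Set.range b)) * ‖affineGrad (b.coord k)‖ ≤ 1 / σ :=
    fun k => by
      rw [le_div_iff₀ hσ]
      have h3 := mul_le_mul_of_nonneg_right h (norm_nonneg (affineGrad (b.coord k)))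
      linarith [inscribedDiam_mul_norm_grad_le b k]
  rw [affineGrad_sub]
  calc ‖b i - b j‖ * ‖affineGrad (b.coord j) - affineGrad (b.coord i)‖
      ≤ Metric.diam (convexHull ℝ (Set.range b)) *
        (‖affineGrad (b.coord j)‖ + ‖affineGrad (b.coord i)‖) :=
        mul_le_mul h1 (norm_sub_le _ _) (norm_nonneg _) Metric.diam_nonneg
    _ ≤ 1 / σ + 1 / σ := by rw [mul_add]; exact add_le_add (h2 j) (h2 i)
    _ = 2 / σ := by ring

end

/-! ### Barycentric coordinates on the mesh and the geometry of dual cells -/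

section

set_option linter.unusedSectionVars false

variable {d : ℕ}

theorem centroid_id_eq (F : Finset (Pt d)) (hF : F.Nonempty) :
    F.centroid ℝ id = (F.card : ℝ)⁻¹ • ∑ y ∈ F, y := by
  rw [Finset.centroid_def, Finset.affineCombination_eq_linear_combination _ _ _
    (F.sum_centroidWeights_eq_one_of_nonempty ℝ hF)]
  simp [Finset.centroidWeights, Finset.smul_sum]

/-- Peeling off layers: subtracting the least positive weight on the support `F` removes a multiple
of the centroid of `F`, a face containing `z` because `z` has maximal weight. The support shrinks
and `z` stays maximal. Weights are not normalised, so that the induction can continue. -/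
theorem exists_mem_cornerCell_smul (K : Finset (Pt d)) {z : Pt d} (hz : z ∈ K) (n : ℕ) :
    ∀ w : Pt d → ℝ, (∀ y ∈ K, 0 ≤ w y ∧ w y ≤ w z) → (K.filter fun y => w y ≠ 0).card = n →
      ∃ c ∈ cornerCell K z, ∑ y ∈ K, w y • y = (∑ y ∈ K, w y) • c := by
  classical
  induction n using Nat.strong_induction_on with
  | _ n ih =>
    intro w hw hn
    set F := K.filter fun y => w y ≠ 0 with hF
    rcases F.eq_empty_or_nonempty with h0 | hne
    · have hw0 : ∀ y ∈ K, w y = 0 := fun y hy => by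
        by_contra h
        have : y ∈ F := Finset.mem_filter.2 ⟨hy, h⟩
        rw [h0] at this; simp at this
      refine ⟨z, subset_convexHull ℝ _ ⟨{z}, by simpa, by simp, by
        rw [centroid_id_eq _ (Finset.singleton_nonempty z)]; simp⟩, ?_⟩
      rw [Finset.sum_congr rfl fun y hy => by rw [hw0 y hy, zero_smul], Finset.sum_eq_zero hw0]
      simp
    · obtain ⟨u, huF, hu⟩ := Finset.exists_min_image F w hne
      have huK := (Finset.mem_filter.1 huF).1
      have hm : 0 < w u := lt_of_le_of_ne (hw u huK).1 (Ne.symm (Finset.mem_filter.1 huF).2)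
      have hzF : z ∈ F := Finset.mem_filter.2 ⟨hz, (hm.trans_le (hw u huK).2).ne'⟩
      set w' : Pt d → ℝ := fun y => w y - if y ∈ F then w u else 0 with hw'
      have hw'F : ∀ y ∈ F, w' y = w y - w u := fun y hy => by simp [hw', hy]
      have hw'0 : ∀ y ∈ K, y ∉ F → w' y = 0 := fun y hy hyF => by
        have : w y = 0 := by
          by_contra h
          exact hyF (Finset.mem_filter.2 ⟨hy, h⟩)
        simp [hw', hyF, this]
      obtain ⟨c, hc, hsum⟩ := ih (K.filter fun y => w' y ≠ 0).card (by
        rw [← hn]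
        refine Finset.card_lt_card ⟨fun y hy => ?_, fun hsub => ?_⟩
        · rw [Finset.mem_filter] at hy
          by_contra h
          exact hy.2 (hw'0 y hy.1 h)
        · have := (Finset.mem_filter.1 (hsub huF)).2
          exact this (by rw [hw'F u huF, sub_self])) w' (fun y hy => by
        by_cases hyF : y ∈ F
        · rw [hw'F y hyF, hw'F z hzF]
          exact ⟨sub_nonneg.2 (hu y hyF), sub_le_sub_right (hw y hy).2 _⟩
        · rw [hw'0 y hy hyF, hw'F z hzF]
          exact ⟨le_rfl, sub_nonneg.2 (hw u huK).2⟩) rfl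
      have hFK : F ⊆ K := Finset.filter_subset _ _
      have hcard : 0 < (F.card : ℝ) := Nat.cast_pos.2 hne.card_pos
      have e1 : ∑ y ∈ K, w y • y =
          (w u * F.card) • F.centroid ℝ id + ∑ y ∈ K, w' y • y := by
        rw [centroid_id_eq F hne, smul_smul, mul_assoc, mul_inv_cancel₀ hcard.ne', mul_one,
          Finset.smul_sum, ← Finset.sum_filter_add_sum_filter_not K (· ∈ F) (fun y => w y • y),
          ← Finset.sum_filter_add_sum_filter_not K (· ∈ F) (fun y => w' y • y),
          Finset.filter_mem_eq_inter, Finset.inter_eq_right.2 hFK, ← add_assoc,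
          ← Finset.sum_add_distrib]
        congr 1
        · exact Finset.sum_congr rfl fun y hy => by rw [hw'F y hy, ← add_smul]; congr 1; ring
        · exact Finset.sum_congr rfl fun y hy => by
            simp [hw', (Finset.mem_filter.1 hy).2]
      have e2 : ∑ y ∈ K, w y = w u * F.card + ∑ y ∈ K, w' y := by
        simp only [hw', Finset.sum_sub_distrib, ← Finset.sum_filter, Finset.filter_mem_eq_inter,
          Finset.inter_eq_right.2 hFK, Finset.sum_const, nsmul_eq_mul]
        ring
      have hs' : 0 ≤ ∑ y ∈ K, w' y := Finset.sum_nonneg fun y hy => by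
        by_cases hyF : y ∈ F
        · rw [hw'F y hyF]; exact sub_nonneg.2 (hu y hyF)
        · rw [hw'0 y hy hyF]
      set a := w u * F.card with ha
      set s := ∑ y ∈ K, w' y with hs
      have ha0 : 0 < a := by positivity
      have has : 0 < a + s := by linarith
      refine ⟨(a / (a + s)) • F.centroid ℝ id + (s / (a + s)) • c, ?_, ?_⟩
      · have hcen : F.centroid ℝ id ∈ cornerCell K z := subset_convexHull ℝ _ ⟨F, hFK, hzF, rfl⟩
        refine (convex_convexHull ℝ _ : Convex ℝ (cornerCell K z)) hcen hc
          (by positivity) (by positivity) ?_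
        rw [← add_div, div_self has.ne']
      · rw [e1, e2, hsum, smul_add, smul_smul, smul_smul, mul_div_cancel₀ _ has.ne',
          mul_div_cancel₀ _ has.ne']

namespace Triangulation

variable {S : Set (Pt d)} (T : Triangulation S)

theorem mem_elements {K : Finset (Pt d)} : K ∈ T.elements ↔ K ∈ T.faces ∧ K.card = d + 1 := by
  simp [elements]

/-- The vertices of an element, as an affine basis. -/
def elemBasis (K : T.elements) : AffineBasis K.1 ℝ (Pt d) where
  toFun := Subtype.val
  ind' := T.indep (T.mem_elements.1 K.2).1
  tot' := by
    rw [(T.indep (T.mem_elements.1 K.2).1).affineSpan_eq_top_iff_card_eq_finrank_add_one]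
    simpa using (T.mem_elements.1 K.2).2

@[simp]
theorem elemBasis_apply (K : T.elements) (y : K.1) : T.elemBasis K y = y := rfl

theorem range_elemBasis (K : T.elements) : Set.range (T.elemBasis K) = (K.1 : Set (Pt d)) := by
  ext x
  constructor
  · rintro ⟨y, rfl⟩; exact y.2
  · intro hx; exact ⟨⟨x, hx⟩, rfl⟩

/-- The closed simplex spanned by an element. -/
def cell (K : T.elements) : Set (Pt d) := convexHull ℝ (K.1 : Set (Pt d))

theorem cell_eq (K : T.elements) : T.cell K = convexHull ℝ (Set.range (T.elemBasis K)) := by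
  rw [range_elemBasis]; rfl

open Classical in
/-- The barycentric coordinate of a point with respect to a vertex, `0` for points that are not
vertices of the element. -/
def lam (K : T.elements) (z x : Pt d) : ℝ :=
  if h : z ∈ K.1 then (T.elemBasis K).coord ⟨z, h⟩ x else 0

theorem lam_coe (K : T.elements) (y : K.1) (x : Pt d) :
    T.lam K y x = (T.elemBasis K).coord y x := by
  simp [lam]

theorem lam_of_notMem (K : T.elements) {z : Pt d} (h : z ∉ K.1) (x : Pt d) : T.lam K z x = 0 := by
  simp [lam, h]

theorem mem_of_lam_pos {K : T.elements} {z x : Pt d} (h : 0 < T.lam K z x) : z ∈ K.1 := by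
  by_contra h'
  rw [T.lam_of_notMem K h'] at h
  exact h.false

theorem continuous_lam (K : T.elements) (z : Pt d) : Continuous (T.lam K z) := by
  by_cases h : z ∈ K.1
  · have : T.lam K z = (T.elemBasis K).coord ⟨z, h⟩ := funext fun x => T.lam_coe K ⟨z, h⟩ x
    rw [this]; exact continuous_affine _
  · have : T.lam K z = fun _ => 0 := funext fun x => T.lam_of_notMem K h x
    rw [this]; exact continuous_const

theorem mem_cell_iff (K : T.elements) (x : Pt d) : x ∈ T.cell K ↔ ∀ z, 0 ≤ T.lam K z x := by
  rw [cell_eq, simplex_eq]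
  constructor
  · intro h z
    by_cases hz : z ∈ K.1
    · rw [show T.lam K z x = _ from T.lam_coe K ⟨z, hz⟩ x]; exact h _
    · rw [T.lam_of_notMem K hz]
  · intro h z
    rw [← lam_coe]; exact h z

theorem mem_interior_cell_iff (K : T.elements) (x : Pt d) :
    x ∈ interior (T.cell K) ↔ ∀ z ∈ K.1, 0 < T.lam K z x := by
  rw [cell_eq, AffineBasis.interior_convexHull]
  constructor
  · intro h z hz
    rw [show T.lam K z x = _ from T.lam_coe K ⟨z, hz⟩ x]; exact h _
  · intro h z
    rw [← lam_coe]; exact h z z.2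

theorem sum_lam (K : T.elements) (x : Pt d) : ∑ z ∈ K.1, T.lam K z x = 1 := by
  rw [← Finset.sum_coe_sort, ← (T.elemBasis K).sum_coord_apply_eq_one x]
  exact Finset.sum_congr rfl fun y _ => T.lam_coe K y x

theorem sum_lam_smul (K : T.elements) (x : Pt d) : ∑ z ∈ K.1, T.lam K z x • z = x := by
  rw [← Finset.sum_coe_sort]
  conv_rhs => rw [← (T.elemBasis K).linear_combination_coord_eq_self x]
  exact Finset.sum_congr rfl fun y _ => by rw [lam_coe]; rfl

theorem lam_eq_of_sum (K : T.elements) {x : Pt d} {w : Pt d → ℝ} (hw : ∀ z ∉ K.1, w z = 0)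
    (h1 : ∑ z ∈ K.1, w z = 1) (hx : ∑ z ∈ K.1, w z • z = x) (z : Pt d) : T.lam K z x = w z := by
  by_cases hz : z ∈ K.1
  · rw [← Finset.sum_coe_sort] at h1 hx
    have h2 := (T.elemBasis K).coord_apply_combination_of_mem (Finset.mem_univ ⟨z, hz⟩) h1
    rw [Finset.affineCombination_eq_linear_combination _ _ _ h1] at h2
    simp only [elemBasis_apply] at h2
    rw [hx, ← lam_coe] at h2
    exact h2
  · rw [T.lam_of_notMem K hz, hw z hz]

/-- By conformity `x` is a convex combination of common vertices, and barycentric coordinates are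
unique. With the extension by zero, `lam` is thus a globally well-defined hat function. -/
theorem lam_eq_lam (K K' : T.elements) {x : Pt d} (hx : x ∈ T.cell K) (hx' : x ∈ T.cell K')
    (z : Pt d) : T.lam K z x = T.lam K' z x := by
  classical
  have h := T.inter_subset_convexHull (T.mem_elements.1 K.2).1 (T.mem_elements.1 K'.2).1 ⟨hx, hx'⟩
  rw [← Finset.coe_inter, Finset.mem_convexHull'] at h
  obtain ⟨w, -, hw1, hwx⟩ := h
  set w' : Pt d → ℝ := fun y => if y ∈ K.1 ∩ K'.1 then w y else 0 with hw'
  have key : ∀ L : T.elements, K.1 ∩ K'.1 ⊆ L.1 → T.lam L z x = w' z := by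
    intro L hL
    refine T.lam_eq_of_sum L (fun y hy => ?_) ?_ ?_ z
    · exact if_neg fun h => hy (hL h)
    · rw [← hw1, ← Finset.sum_subset hL fun y _ hy => if_neg hy]
      exact Finset.sum_congr rfl fun y hy => if_pos hy
    · rw [← hwx, ← Finset.sum_subset hL fun y _ hy => by rw [hw']; simp only; rw [if_neg hy, zero_smul]]
      exact Finset.sum_congr rfl fun y hy => by rw [hw']; simp only; rw [if_pos hy]
  rw [key K Finset.inter_subset_left, key K' Finset.inter_subset_right]

/-- All vertices of `K` have a positive coordinate at `x`, also with respect to `K'`, so they are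
vertices of `K'`; both have `d + 1` of them. -/
theorem eq_of_mem_interior (K K' : T.elements) {x : Pt d} (hx : x ∈ interior (T.cell K))
    (hx' : x ∈ T.cell K') : K = K' := by
  have h : K.1 ⊆ K'.1 := fun z hz => T.mem_of_lam_pos (x := x) (by
    rw [← T.lam_eq_lam K K' (interior_subset hx) hx']
    exact (T.mem_interior_cell_iff K x).1 hx z hz)
  exact Subtype.ext (Finset.eq_of_subset_of_card_le h (by
    rw [(T.mem_elements.1 K.2).2, (T.mem_elements.1 K'.2).2]))

theorem mem_closure_iff_exists_cell (x : Pt d) : x ∈ closure S ↔ ∃ K, x ∈ T.cell K := by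
  rw [← T.space_eq, Geometry.SimplicialComplex.mem_space_iff]
  constructor
  · rintro ⟨s, hs, hx⟩
    obtain ⟨K, hK, hsK, hcard⟩ := T.pure s hs
    exact ⟨⟨K, T.mem_elements.2 ⟨hK, hcard⟩⟩, convexHull_mono (by exact_mod_cast hsK) hx⟩
  · rintro ⟨K, hK⟩
    exact ⟨K.1, (T.mem_elements.1 K.2).1, hK⟩

theorem isCompact_cell (K : T.elements) : IsCompact (T.cell K) :=
  K.1.finite_toSet.isCompact_convexHull ℝ

/-- The barycenters of the faces through `z` satisfy the inequalities, which define a convex set;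
the converse is the layer decomposition of the coordinates of `x`. -/
theorem mem_cornerCell_iff (K : T.elements) {z : Pt d} (hz : z ∈ K.1) (x : Pt d) :
    x ∈ cornerCell K.1 z ↔ x ∈ T.cell K ∧ ∀ y, T.lam K y x ≤ T.lam K z x := by
  classical
  constructor
  · intro hx
    have hconv : Convex ℝ {x | x ∈ T.cell K ∧ ∀ y, T.lam K y x ≤ T.lam K z x} := by
      rintro p ⟨hp, hp'⟩ q ⟨hq, hq'⟩ a c ha hc hac
      refine ⟨convex_convexHull ℝ _ hp hq ha hc hac, fun y => ?_⟩
      have hlin : ∀ y, T.lam K y (a • p + c • q) = a * T.lam K y p + c * T.lam K y q := by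
        intro y
        by_cases hy : y ∈ K.1
        · have := Convex.combo_affine_apply (f := (T.elemBasis K).coord ⟨y, hy⟩) hac (x := p) (y := q)
          simpa [← lam_coe] using this
        · simp [T.lam_of_notMem K hy]
      rw [hlin, hlin]
      exact add_le_add (mul_le_mul_of_nonneg_left (hp' y) ha) (mul_le_mul_of_nonneg_left (hq' y) hc)
    refine convexHull_min ?_ hconv hx
    rintro p ⟨F, hFK, hzF, rfl⟩
    have hne : F.Nonempty := ⟨z, hzF⟩
    have hcard : 0 < (F.card : ℝ) := Nat.cast_pos.2 hne.card_pos
    have hl : ∀ y, T.lam K y (F.centroid ℝ id) = if y ∈ F then (F.card : ℝ)⁻¹ else 0 := by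
      refine T.lam_eq_of_sum K (fun y hy => if_neg fun h => hy (hFK h)) ?_ ?_
      · rw [← Finset.sum_subset hFK fun y _ hy => if_neg hy, Finset.sum_congr rfl fun y hy => if_pos hy]
        simp [hcard.ne']
      · rw [centroid_id_eq F hne, ← Finset.sum_subset hFK fun y _ hy => by rw [if_neg hy, zero_smul],
          Finset.smul_sum]
        exact Finset.sum_congr rfl fun y hy => by rw [if_pos hy]
    refine ⟨(T.mem_cell_iff K _).2 fun y => ?_, fun y => ?_⟩
    · rw [hl]; split_ifs <;> positivity
    · rw [hl, hl, if_pos hzF]; split_ifs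
      · exact le_rfl
      · positivity
  · rintro ⟨hx, hmax⟩
    obtain ⟨c, hc, h⟩ := exists_mem_cornerCell_smul K.1 hz _ (fun y => T.lam K y x)
      (fun y _ => ⟨(T.mem_cell_iff K x).1 hx y, hmax y⟩) rfl
    rw [sum_lam_smul, sum_lam, one_smul] at h
    rwa [h]

/-- Any element containing `x` can serve for the test, since the coordinates agree. A maximal
coordinate is positive because the sum is `1`, so `z` is automatically a vertex of `K`. -/
theorem mem_dualCell_iff {K : T.elements} {x : Pt d} (hx : x ∈ T.cell K) (z : Pt d) :
    x ∈ T.dualCell z ↔ ∀ y, T.lam K y x ≤ T.lam K z x := by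
  simp only [dualCell, Set.mem_iUnion, exists_prop]
  constructor
  · rintro ⟨K', hK', hz, hx'⟩ y
    rw [T.mem_cornerCell_iff ⟨K', hK'⟩ hz] at hx'
    rw [T.lam_eq_lam K ⟨K', hK'⟩ hx hx'.1, T.lam_eq_lam K ⟨K', hK'⟩ hx hx'.1]
    exact hx'.2 y
  · intro h
    have hpos : 0 < T.lam K z x := by
      by_contra hneg
      have := T.sum_lam K x
      rw [Finset.sum_eq_zero fun y _ => le_antisymm ((h y).trans (not_lt.1 hneg))
        ((T.mem_cell_iff K x).1 hx y)] at this
      norm_num at this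
    have hz := T.mem_of_lam_pos hpos
    exact ⟨K.1, K.2, hz, (T.mem_cornerCell_iff K hz x).2 ⟨hx, h⟩⟩

theorem exists_cell_of_mem_dualCell {z x : Pt d} (hx : x ∈ T.dualCell z) :
    ∃ K : T.elements, z ∈ K.1 ∧ x ∈ T.cell K := by
  simp only [dualCell, Set.mem_iUnion, exists_prop] at hx
  obtain ⟨K, hK, hz, h⟩ := hx
  exact ⟨⟨K, hK⟩, hz, ((T.mem_cornerCell_iff ⟨K, hK⟩ hz x).1 h).1⟩

theorem isClosed_dualCell (z : Pt d) : IsClosed (T.dualCell z) := by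
  refine isClosed_biUnion_finset fun K hK => isClosed_iUnion_of_finite fun hz => ?_
  have : cornerCell K z = T.cell ⟨K, hK⟩ ∩ ⋂ y, {x | T.lam ⟨K, hK⟩ y x ≤ T.lam ⟨K, hK⟩ z x} := by
    ext x
    rw [T.mem_cornerCell_iff ⟨K, hK⟩ hz]
    simp
  rw [this]
  exact (T.isCompact_cell _).isClosed.inter (isClosed_iInter fun y =>
    isClosed_le (T.continuous_lam _ y) (T.continuous_lam _ z))

/-- The finitely many closed cells that miss `x` also miss a neighbourhood of it. -/
theorem eventually_exists_cell (hS : IsOpen S) {x : Pt d} (hx : x ∈ S) :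
    ∀ᶠ y in nhds x, ∃ K : T.elements, y ∈ T.cell K ∧ x ∈ T.cell K := by
  have h1 : ∀ᶠ y in nhds x, ∀ K : T.elements, y ∈ T.cell K → x ∈ T.cell K := by
    rw [Filter.eventually_all]
    intro K
    by_cases h : x ∈ T.cell K
    · exact Filter.Eventually.of_forall fun _ _ => h
    · filter_upwards [(T.isCompact_cell K).isClosed.isOpen_compl.mem_nhds h] with y hy hy'
      exact absurd hy' hy
  filter_upwards [h1, hS.mem_nhds hx] with y hy hyS
  obtain ⟨K, hK⟩ := (T.mem_closure_iff_exists_cell y).1 (subset_closure hyS)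
  exact ⟨K, hK, hy K hK⟩

/-- A strict maximum persists by continuity in each of the finitely many cells at `x`, and these
cover a neighbourhood. Consequently a frontier point of a dual cell inside `S` has a tie for the
maximum. -/
theorem dualCell_mem_nhds (hS : IsOpen S) {x : Pt d} (hx : x ∈ S) {K : T.elements}
    (hK : x ∈ T.cell K) {z : Pt d} (hz : ∀ y ∈ K.1, y ≠ z → T.lam K y x < T.lam K z x) :
    T.dualCell z ∈ nhds x := by
  have hpos : 0 < T.lam K z x := by
    by_contra hneg
    have h2 : ∀ y ∈ K.1, T.lam K y x = 0 := fun y hy => by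
      refine le_antisymm ?_ ((T.mem_cell_iff K x).1 hK y)
      by_cases hyz : y = z
      · rw [hyz]; exact not_lt.1 hneg
      · exact ((hz y hy hyz).trans_le (not_lt.1 hneg)).le
    have := T.sum_lam K x
    rw [Finset.sum_eq_zero h2] at this
    norm_num at this
  have h1 : ∀ᶠ x' in nhds x, ∀ K' : T.elements, x ∈ T.cell K' → ∀ y : K'.1, (y : Pt d) ≠ z →
      T.lam K' y x' < T.lam K' z x' := by
    rw [Filter.eventually_all]
    intro K'
    by_cases h : x ∈ T.cell K'
    · simp only [h, true_imp_iff]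
      rw [Filter.eventually_all]
      intro y
      by_cases hyz : (y : Pt d) = z
      · exact Filter.Eventually.of_forall fun _ h => absurd hyz h
      · have hlt : T.lam K' y x < T.lam K' z x := by
          rw [T.lam_eq_lam K' K h hK, T.lam_eq_lam K' K h hK]
          by_cases hyK : (y : Pt d) ∈ K.1
          · exact hz y hyK hyz
          · rwa [T.lam_of_notMem K hyK]
        filter_upwards [(isOpen_lt (T.continuous_lam K' y) (T.continuous_lam K' z)).mem_nhds hlt]
          with x' hx' _
        exact hx'
    · exact Filter.Eventually.of_forall fun _ h' => absurd h' h
  filter_upwards [h1, T.eventually_exists_cell hS hx] with x' h2 h3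
  obtain ⟨K', hK', hxK'⟩ := h3
  rw [T.mem_dualCell_iff hK']
  intro y
  by_cases hyK : y ∈ K'.1
  · by_cases hyz : y = z
    · rw [hyz]
    · exact (h2 K' hxK' ⟨y, hyK⟩ hyz).le
  · rw [T.lam_of_notMem K' hyK]
    exact (T.mem_cell_iff K' x').1 hK' z

theorem interior_cell_subset (hS : IsOpen S) (hSc : Convex ℝ S) (K : T.elements) :
    interior (T.cell K) ⊆ S := by
  have h1 : T.cell K ⊆ closure S := fun x hx => (T.mem_closure_iff_exists_cell x).2 ⟨K, hx⟩
  have h2 := interior_mono h1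
  rcases S.eq_empty_or_nonempty with h | h
  · have h3 : interior (closure S) = ∅ := by rw [h, closure_empty, interior_empty]
    exact (h2.trans h3.subset).trans (Set.empty_subset _)
  · rwa [hSc.interior_closure_eq_interior_of_nonempty_interior (by rwa [hS.interior_eq]),
      hS.interior_eq] at h2

end Triangulation

end

/-! ### Outward normals and fluxes through the boundaries of dual cells -/

section

set_option linter.unusedSectionVars false

variable {d : ℕ}

theorem IsOutwardUnitNormal.unique {C : Set (Pt d)} {x η η' : Pt d}
    (h : IsOutwardUnitNormal C x η) (h' : IsOutwardUnitNormal C x η') : η = η' := by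
  obtain ⟨h1, ε, hε, he⟩ := h
  obtain ⟨h1', ε', hε', he'⟩ := h'
  -- Two half-spaces that agree near `x` agree everywhere, by scaling. Testing with `η - c η'` gives
  -- `c² ≥ 1`, and testing with `η'` gives `c > 0`.
  have key : ∀ v : Pt d, inner ℝ v η ≤ 0 ↔ inner ℝ v η' ≤ 0 := by
    intro v
    have hn : 0 < ‖v‖ + 1 := by positivity
    set t : ℝ := min ε ε' / (‖v‖ + 1) with ht
    have ht0 : 0 < t := by positivity
    have hlt : ‖t • v‖ < min ε ε' := by
      rw [norm_smul, Real.norm_of_nonneg ht0.le, ht, div_mul_eq_mul_div, div_lt_iff₀ hn]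
      exact mul_lt_mul_of_pos_left (by linarith) (by positivity)
    have hmem : ∀ δ, min ε ε' ≤ δ → x + t • v ∈ Metric.ball x δ := fun δ hδ => by
      rw [mem_ball_iff_norm, add_sub_cancel_left]; exact hlt.trans_le hδ
    have e1 := he _ (hmem ε (min_le_left _ _))
    have e2 := he' _ (hmem ε' (min_le_right _ _))
    rw [add_sub_cancel_left, inner_smul_left] at e1 e2
    simp only [conj_trivial] at e1 e2
    have hs : ∀ a : ℝ, t * a ≤ 0 ↔ a ≤ 0 := fun a =>
      ⟨fun h => by by_contra hc; exact absurd h (not_le.2 (mul_pos ht0 (not_le.1 hc))),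
        fun h => mul_nonpos_of_nonneg_of_nonpos ht0.le h⟩
    rw [← hs (inner ℝ v η), ← hs (inner ℝ v η')]
    exact e1.symm.trans e2
  set c := inner ℝ η η' with hc
  have hηη : inner ℝ η η = (1 : ℝ) := by rw [real_inner_self_eq_norm_sq, h1]; norm_num
  have hηη' : inner ℝ η' η' = (1 : ℝ) := by rw [real_inner_self_eq_norm_sq, h1']; norm_num
  have h2 : 1 - c * c ≤ 0 := by
    have := (key (η - c • η')).2 (by
      rw [inner_sub_left, inner_smul_left, hηη', ← hc]; simp)
    rw [inner_sub_left, inner_smul_left, hηη, real_inner_comm] at this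
    simpa using this
  have h3 : 0 < c := by
    by_contra hneg
    have := (key η').1 (by rw [real_inner_comm]; exact not_lt.1 hneg)
    rw [hηη'] at this
    norm_num at this
  have h4 : c ≤ 1 := by
    have := real_inner_le_norm η η'
    rwa [h1, h1', one_mul] at this
  have h5 : c = 1 := by nlinarith
  exact (inner_eq_one_iff_of_norm_eq_one h1 h1').1 h5

theorem IsOutwardUnitNormal.outwardNormal_eq {C : Set (Pt d)} {x η : Pt d}
    (h : IsOutwardUnitNormal C x η) : outwardNormal C x = η := by
  have hex : ∃ η, IsOutwardUnitNormal C x η := ⟨η, h⟩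
  rw [outwardNormal, dif_pos hex]
  exact hex.choose_spec.unique h

theorem IsOutwardUnitNormal.mem_frontier {C : Set (Pt d)} {x η : Pt d}
    (h : IsOutwardUnitNormal C x η) : x ∈ frontier C := by
  obtain ⟨h1, ε, hε, he⟩ := h
  have hx : x ∈ C := (he x (Metric.mem_ball_self hε)).2 (by simp)
  refine ⟨subset_closure hx, fun hint => ?_⟩
  obtain ⟨δ, hδ, hsub⟩ := Metric.mem_nhds_iff.1 (mem_interior_iff_mem_nhds.1 hint)
  set t := min ε δ / 2 with ht
  have ht0 : 0 < t := by positivity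
  have hlt : t < min ε δ := half_lt_self (by positivity)
  have hmem : ∀ r, min ε δ ≤ r → x + t • η ∈ Metric.ball x r := fun r hr => by
    rw [mem_ball_iff_norm, add_sub_cancel_left, norm_smul, Real.norm_of_nonneg ht0.le, h1, mul_one]
    exact hlt.trans_le hr
  have := (he _ (hmem ε (min_le_left _ _))).1 (hsub (hmem δ (min_le_right _ _)))
  rw [add_sub_cancel_left, inner_smul_left, real_inner_self_eq_norm_sq, h1] at this
  simp at this
  linarith

/-- The product of a matrix and a vector of Euclidean space. -/
def matVec (M : Matrix (Fin d) (Fin d) ℝ) (v : Pt d) : Pt d := WithLp.toLp 2 (M.mulVec v.ofLp)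

theorem dotProduct_ofLp (v w : Pt d) : v.ofLp ⬝ᵥ w.ofLp = inner ℝ v w := by
  rw [EuclideanSpace.inner_eq_star_dotProduct, dotProduct_comm]
  simp

theorem inner_matVec (M : Matrix (Fin d) (Fin d) ℝ) (v w : Pt d) :
    inner ℝ (matVec M v) w = M.mulVec v.ofLp ⬝ᵥ w.ofLp :=
  (dotProduct_ofLp (matVec M v) w).symm

namespace Triangulation

variable {S : Set (Pt d)} (T : Triangulation S)

/-- Near a point of the facet only `λ_i` and `λ_j` compete for the maximum, so the dual cell of `i`
is locally the half-space `λ_j ≤ λ_i`. -/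
theorem isOutwardUnitNormal_facet (K : T.elements) {i j : K.1} (hij : i ≠ j) {x : Pt d}
    (hx : x ∈ facet (T.elemBasis K) i j) :
    IsOutwardUnitNormal (T.dualCell i) x (facetNormal (T.elemBasis K) i j) := by
  set b := T.elemBasis K with hb
  have hG := affineGrad_coord_sub_ne_zero b hij
  have hn : 0 < ‖affineGrad (b.coord j - b.coord i)‖ := norm_pos_iff.2 hG
  refine ⟨?_, ?_⟩
  · rw [facetNormal, norm_smul, norm_inv, norm_norm, inv_mul_cancel₀ hn.ne']
  · have hev : ∀ᶠ y in nhds x, y ∈ T.cell K ∧ ∀ k, k ≠ i → k ≠ j → b.coord k y < b.coord i y := by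
      refine Filter.Eventually.and ?_ ?_
      · refine mem_interior_iff_mem_nhds.1 ?_
        change x ∈ interior (T.cell K)
        rw [cell_eq, AffineBasis.interior_convexHull]; exact hx.1
      · rw [Filter.eventually_all]
        intro k
        by_cases hki : k = i
        · exact Filter.Eventually.of_forall fun _ h => absurd hki h
        · by_cases hkj : k = j
          · exact Filter.Eventually.of_forall fun _ _ h => absurd hkj h
          · filter_upwards [(isOpen_lt (continuous_affine (b.coord k))
              (continuous_affine (b.coord i))).mem_nhds (hx.2.2 k hki hkj)] with y hy _ _
            exact hy
    obtain ⟨ε, hε, he⟩ := Metric.eventually_nhds_iff_ball.1 hev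
    refine ⟨ε, hε, fun y hy => ?_⟩
    obtain ⟨hyK, hlt⟩ := he y hy
    have h1 : inner ℝ (y - x) (facetNormal b i j) =
        ‖affineGrad (b.coord j - b.coord i)‖⁻¹ * (b.coord j y - b.coord i y) := by
      rw [facetNormal, inner_smul_right, real_inner_comm, ← affine_sub_eq]
      simp only [AffineMap.coe_sub, Pi.sub_apply]
      rw [hx.2.1, sub_self, sub_zero]
    rw [h1, T.mem_dualCell_iff hyK]
    have h2 : ‖affineGrad (b.coord j - b.coord i)‖⁻¹ * (b.coord j y - b.coord i y) ≤ 0 ↔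
        b.coord j y ≤ b.coord i y := by
      rw [← sub_nonpos (b := b.coord i y)]
      constructor
      · intro h
        by_contra hc
        exact absurd h (not_le.2 (mul_pos (inv_pos.2 hn) (not_le.1 hc)))
      · exact mul_nonpos_of_nonneg_of_nonpos (inv_pos.2 hn).le
    rw [h2]
    constructor
    · intro h
      have := h j
      rwa [lam_coe, lam_coe] at this
    · intro h z
      by_cases hz : z ∈ K.1
      · rw [show z = ((⟨z, hz⟩ : K.1) : Pt d) from rfl, lam_coe, lam_coe]
        by_cases hki : (⟨z, hz⟩ : K.1) = i
        · rw [hki]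
        · by_cases hkj : (⟨z, hz⟩ : K.1) = j
          · rw [hkj]; exact h
          · exact (hlt _ hki hkj).le
      · rw [T.lam_of_notMem K hz]
        exact (T.mem_cell_iff K y).1 hyK _

open Classical in
/-- The facets of the control volume of `z` inside the elements. -/
def facetIndex (z : Pt d) : Finset (Σ K : T.elements, K.1 × K.1) :=
  Finset.univ.filter fun p => (p.2.1 : Pt d) = z ∧ p.2.1 ≠ p.2.2

/-- The facet between the control volumes of two vertices of an element. -/
def elemFacet (p : Σ K : T.elements, K.1 × K.1) : Set (Pt d) :=
  facet (T.elemBasis p.1) p.2.1 p.2.2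

theorem mem_facetIndex {z : Pt d} {p : Σ K : T.elements, K.1 × K.1} :
    p ∈ T.facetIndex z ↔ (p.2.1 : Pt d) = z ∧ p.2.1 ≠ p.2.2 := by
  simp [facetIndex]

theorem elemFacet_subset_interior (p : Σ K : T.elements, K.1 × K.1) :
    T.elemFacet p ⊆ interior (T.cell p.1) := fun x hx => by
  rw [cell_eq, AffineBasis.interior_convexHull]; exact hx.1

theorem facet_eq_of_mem {K : T.elements} {i j j' : K.1} (hj' : i ≠ j) {x : Pt d}
    (hx : x ∈ facet (T.elemBasis K) i j) (hx' : x ∈ facet (T.elemBasis K) i j') : j = j' := by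
  by_contra hne
  exact (hx'.2.2 j hj'.symm hne).ne hx.2.1.symm

theorem elemFacet_injOn {z : Pt d} {p q : Σ K : T.elements, K.1 × K.1} (hp : p ∈ T.facetIndex z)
    (hq : q ∈ T.facetIndex z) {x : Pt d} (hx : x ∈ T.elemFacet p) (hx' : x ∈ T.elemFacet q) :
    p = q := by
  rw [mem_facetIndex] at hp hq
  have hK : p.1 = q.1 := T.eq_of_mem_interior p.1 q.1 (T.elemFacet_subset_interior p hx)
    (interior_subset (T.elemFacet_subset_interior q hx'))
  rcases p with ⟨K, i, j⟩
  rcases q with ⟨K', i', j'⟩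
  dsimp only at hK hp hq
  subst hK
  have hi : i = i' := Subtype.ext (hp.1.trans hq.1.symm)
  subst hi
  rw [T.facet_eq_of_mem hp.2 hx hx']

theorem pairwise_disjoint_elemFacet (z : Pt d) :
    (T.facetIndex z : Set (Σ K : T.elements, K.1 × K.1)).Pairwise
      (Function.onFun Disjoint T.elemFacet) := fun _ hp _ hq hpq =>
  Set.disjoint_left.2 fun _ hx hx' => hpq (T.elemFacet_injOn hp hq hx hx')

/-- On the closed interface, the strict inequalities of `facet` fail only where a third coordinate
vanishes or joins the tie; each case confines the point to a second, transversal hyperplane. -/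
theorem facet_boundary_null (K : T.elements) {i j : K.1} (hij : i ≠ j) :
    μHE[d - 1] ({x | x ∈ T.cell K ∧ T.lam K i x = T.lam K j x ∧ ∀ y, T.lam K y x ≤ T.lam K i x} \
      facet (T.elemBasis K) i j) = 0 := by
  classical
  set b := T.elemBasis K with hb
  have hnull : ∀ f : Pt d →ᵃ[ℝ] ℝ, f.linear ((1 / 2 : ℝ) • (b j - b i)) = 0 →
      (∃ w, f.linear w ≠ 0) → μHE[d - 1] {x | (b.coord j - b.coord i) x = 0 ∧ f x = 0} = 0 :=
    fun f hf ⟨w, hw⟩ => surface_null _ f (linear_half_edge b hij) hf hw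
  -- A triple tie is written `λ_i + λ_j - 2 λ_k = 0` because `surface_null` needs a function that is
  -- constant along the edge from `i` to `j`.
  refine measure_mono_null (t := ⋃ k : K.1, ⋃ _ : k ≠ i, ⋃ _ : k ≠ j,
    ({x | (b.coord j - b.coord i) x = 0 ∧ b.coord k x = 0} ∪
      {x | (b.coord j - b.coord i) x = 0 ∧
        (b.coord i + b.coord j - (2 : ℝ) • b.coord k) x = 0})) ?_ ?_
  · rintro x ⟨⟨hxK, h1, h2⟩, hx⟩
    rw [lam_coe, lam_coe] at h1
    have h2' : ∀ k, b.coord k x ≤ b.coord i x := fun k => by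
      have := h2 k; rwa [lam_coe, lam_coe] at this
    have h0 : ∀ k, 0 ≤ b.coord k x := fun k => by
      have := (T.mem_cell_iff K x).1 hxK k; rwa [lam_coe] at this
    have hpos : 0 < b.coord i x := by
      refine lt_of_le_of_ne (h0 i) fun h => ?_
      have := b.sum_coord_apply_eq_one x
      rw [Finset.sum_eq_zero fun k _ => le_antisymm ((h2' k).trans h.symm.le) (h0 k)] at this
      norm_num at this
    have h1' : (b.coord j - b.coord i) x = 0 := by
      rw [AffineMap.coe_sub, Pi.sub_apply, ← h1, sub_self]
    simp only [Set.mem_iUnion]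
    by_contra hcon
    push Not at hcon
    refine hx ⟨fun k => ?_, h1, fun k hki hkj => ?_⟩
    · by_cases hki : k = i
      · rwa [hki]
      by_cases hkj : k = j
      · rw [hkj]; rwa [h1] at hpos
      refine lt_of_le_of_ne (h0 k) fun h => hcon k hki hkj (Or.inl ⟨h1', h.symm⟩)
    · refine lt_of_le_of_ne (h2' k) fun h => hcon k hki hkj (Or.inr ⟨h1', ?_⟩)
      simp only [AffineMap.coe_sub, AffineMap.coe_add, AffineMap.coe_smul, Pi.sub_apply,
        Pi.add_apply, Pi.smul_apply, smul_eq_mul]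
      rw [← h1, h]; ring
  · rw [measure_iUnion_null_iff]
    intro k
    rw [measure_iUnion_null_iff]
    intro hki
    rw [measure_iUnion_null_iff]
    intro hkj
    refine measure_union_null (hnull _ ?_ ⟨b k - b i, ?_⟩) (hnull _ ?_ ⟨b k - b i, ?_⟩)
    · rw [map_smul, coord_linear_sub]; simp [hki, hkj]
    · rw [coord_linear_sub]; simp [hki]
    · rw [map_smul]
      simp only [AffineMap.sub_linear, AffineMap.add_linear, AffineMap.smul_linear,
        LinearMap.sub_apply, LinearMap.add_apply, LinearMap.smul_apply, coord_linear_sub]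
      simp [hki, hkj, hij, hij.symm]
    · simp only [AffineMap.sub_linear, AffineMap.add_linear, AffineMap.smul_linear,
        LinearMap.sub_apply, LinearMap.add_apply, LinearMap.smul_apply, coord_linear_sub]
      simp [hki, hij.symm, Ne.symm hki, Ne.symm hkj]
      norm_num

/-- At a frontier point inside `S` the maximal coordinate of `z` is tied with that of another vertex
of the same element, so the point lies on a closed interface, which is a facet up to a null set.
Conversely, a point with an outward normal is a frontier point, and facets lie inside `S`. -/
theorem ae_eq_iUnion_facets (hS : IsOpen S) (hSc : Convex ℝ S) (z : Pt d) :
    (frontier (T.dualCell z) \ frontier S : Set (Pt d)) =ᵐ[μHE[d - 1]]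
      (⋃ p ∈ T.facetIndex z, T.elemFacet p : Set (Pt d)) := by
  have hsub : (⋃ p ∈ T.facetIndex z, T.elemFacet p : Set (Pt d)) ⊆
      frontier (T.dualCell z) \ frontier S := by
    intro x hx
    simp only [Set.mem_iUnion, exists_prop] at hx
    obtain ⟨p, hp, hx⟩ := hx
    obtain ⟨hp1, hp2⟩ := T.mem_facetIndex.1 hp
    refine ⟨?_, fun hfr => ?_⟩
    · rw [← hp1]
      exact (T.isOutwardUnitNormal_facet p.1 hp2 hx).mem_frontier
    · rw [hS.frontier_eq] at hfr
      exact hfr.2 (T.interior_cell_subset hS hSc p.1 (T.elemFacet_subset_interior p hx))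
  have hnull : μHE[d - 1] ((frontier (T.dualCell z) \ frontier S) \
      (⋃ p ∈ T.facetIndex z, T.elemFacet p)) = 0 := by
    refine measure_mono_null (t := ⋃ p : (Σ K : T.elements, K.1 × K.1),
      ⋃ _ : p ∈ T.facetIndex z, ({x | x ∈ T.cell p.1 ∧ T.lam p.1 p.2.1 x = T.lam p.1 p.2.2 x ∧
        ∀ y, T.lam p.1 y x ≤ T.lam p.1 p.2.1 x} \ facet (T.elemBasis p.1) p.2.1 p.2.2)) ?_ ?_
    · rintro x ⟨⟨hx, hxS⟩, hxF⟩
      have hxd : x ∈ T.dualCell z := (T.isClosed_dualCell z).frontier_subset hx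
      obtain ⟨K, hzK, hxK⟩ := T.exists_cell_of_mem_dualCell hxd
      have hxS' : x ∈ S := by
        by_contra h
        rw [hS.frontier_eq] at hxS
        exact hxS ⟨(T.mem_closure_iff_exists_cell x).2 ⟨K, hxK⟩, h⟩
      have hmax := (T.mem_dualCell_iff hxK z).1 hxd
      have hy : ∃ y ∈ K.1, y ≠ z ∧ T.lam K z x = T.lam K y x := by
        by_contra hcon
        push Not at hcon
        refine hx.2 (mem_interior_iff_mem_nhds.2 (T.dualCell_mem_nhds hS hxS' hxK fun y hy hyz => ?_))
        exact lt_of_le_of_ne (hmax y) (hcon y hy hyz).symm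
      obtain ⟨y, hy, hyz, he⟩ := hy
      have hp : (⟨K, ⟨z, hzK⟩, ⟨y, hy⟩⟩ : Σ K : T.elements, K.1 × K.1) ∈ T.facetIndex z :=
        T.mem_facetIndex.2 ⟨rfl, fun h => hyz (Subtype.ext_iff.1 h).symm⟩
      simp only [Set.mem_iUnion]
      refine ⟨_, hp, ⟨hxK, he, hmax⟩, fun hxf => hxF ?_⟩
      simp only [Set.mem_iUnion]
      exact ⟨_, hp, hxf⟩
    · rw [measure_iUnion_null_iff]
      intro p
      rw [measure_iUnion_null_iff]
      intro hp
      exact T.facet_boundary_null p.1 (T.mem_facetIndex.1 hp).2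
  refine (Filter.EventuallyLE.antisymm ?_ hsub.eventuallyLE)
  exact ae_le_set.2 hnull

theorem flux_eq_sum (hS : IsOpen S) (hSc : Convex ℝ S) (B : Pt d → Matrix (Fin d) (Fin d) ℝ)
    {χ : Pt d → ℝ} {g : T.elements → Pt d →ᵃ[ℝ] ℝ} (hg : ∀ K, Set.EqOn χ (g K) (T.cell K))
    (hint : ∀ (K : T.elements) (i j : K.1), i ≠ j →
      IntegrableOn (fun x => matVec (B x) (affineGrad (g K))) (facet (T.elemBasis K) i j) μHE[d - 1])
    (z : Pt d) :
    T.flux B χ z = ∑ p ∈ T.facetIndex z, ∫ x in T.elemFacet p,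
      inner ℝ (matVec (B x) (affineGrad (g p.1))) (facetNormal (T.elemBasis p.1) p.2.1 p.2.2)
        ∂μHE[d - 1] := by
  have hmeas : ∀ p, MeasurableSet (T.elemFacet p) := fun p => measurableSet_facet _ _ _
  have heq : ∀ p ∈ T.facetIndex z, Set.EqOn (fun x => (B x).mulVec (gradient χ x).ofLp ⬝ᵥ
      (outwardNormal (T.dualCell z) x).ofLp) (fun x => inner ℝ (matVec (B x) (affineGrad (g p.1)))
        (facetNormal (T.elemBasis p.1) p.2.1 p.2.2)) (T.elemFacet p) := by
    intro p hp x hx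
    obtain ⟨hp1, hp2⟩ := T.mem_facetIndex.1 hp
    have h1 : gradient χ x = affineGrad (g p.1) :=
      gradient_of_eqOn isOpen_interior ((hg p.1).mono interior_subset)
        (T.elemFacet_subset_interior p hx)
    have h2 := (T.isOutwardUnitNormal_facet p.1 hp2 hx).outwardNormal_eq
    rw [hp1] at h2
    simp only [h1, h2, inner_matVec]
  rw [flux, setIntegral_congr_set (T.ae_eq_iUnion_facets hS hSc z),
    integral_biUnion_finset _ (fun p _ => hmeas p) (T.pairwise_disjoint_elemFacet z)]
  · exact Finset.sum_congr rfl fun p hp => setIntegral_congr_fun (hmeas p) (heq p hp)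
  · intro p hp
    rw [integrableOn_congr_fun (heq p hp) (hmeas p)]
    exact (hint p.1 p.2.1 p.2.2 (T.mem_facetIndex.1 hp).2).inner_const _

/-- Regroups the facets by element instead of by vertex. Inactive vertices can be included since `χ`
vanishes there, which treats both boundary conditions at once. -/
theorem sum_flux_eq (hS : IsOpen S) (hSc : Convex ℝ S) (bc : BoundaryCondition)
    (B : Pt d → Matrix (Fin d) (Fin d) ℝ)
    {χ : Pt d → ℝ} (hχ : χ ∈ T.trialSpace bc) {g : T.elements → Pt d →ᵃ[ℝ] ℝ}
    (hg : ∀ K, Set.EqOn χ (g K) (T.cell K))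
    (hint : ∀ (K : T.elements) (i j : K.1), i ≠ j →
      IntegrableOn (fun x => matVec (B x) (affineGrad (g K))) (facet (T.elemBasis K) i j) μHE[d - 1]) :
    ∑ z ∈ T.activeVertices bc, χ z * T.flux B χ z =
      ∑ K : T.elements, ∑ i : K.1, g K (T.elemBasis K i) * ∑ j : K.1,
        ∫ x in facet (T.elemBasis K) i j, inner ℝ (matVec (B x) (affineGrad (g K)))
          (facetNormal (T.elemBasis K) i j) ∂μHE[d - 1] := by
  classical
  set I : (Σ K : T.elements, K.1 × K.1) → ℝ := fun p => ∫ x in T.elemFacet p,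
    inner ℝ (matVec (B x) (affineGrad (g p.1))) (facetNormal (T.elemBasis p.1) p.2.1 p.2.2)
      ∂μHE[d - 1] with hI
  have hact : T.activeVertices bc ⊆ T.finite_vertices.toFinset := by
    cases bc
    · exact Finset.filter_subset _ _
    · exact subset_rfl
  have hsum : ∑ z ∈ T.activeVertices bc, χ z * T.flux B χ z =
      ∑ z ∈ T.finite_vertices.toFinset, χ z * T.flux B χ z :=
    Finset.sum_subset hact fun z hz hz' => by
      rw [hχ.2.2.1 z (by simpa using hz) hz', zero_mul]
  have hmem : ∀ (K : T.elements) (i : K.1), (i : Pt d) ∈ T.finite_vertices.toFinset := by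
    intro K i
    rw [Set.Finite.mem_toFinset, Geometry.SimplicialComplex.vertices_eq]
    exact Set.mem_biUnion (T.mem_elements.1 K.2).1 i.2
  have hz : ∀ z, χ z * T.flux B χ z =
      ∑ p ∈ Finset.univ.filter (fun p : Σ K : T.elements, K.1 × K.1 => (p.2.1 : Pt d) = z),
        χ p.2.1 * I p := by
    intro z
    rw [T.flux_eq_sum hS hSc B hg hint, Finset.mul_sum]
    refine (Finset.sum_congr rfl fun p hp => ?_).trans (Finset.sum_subset ?_ ?_)
    · rw [(T.mem_facetIndex.1 hp).1]
    · exact fun p hp => by simpa using (T.mem_facetIndex.1 hp).1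
    · intro p hp hp'
      have h1 : p.2.1 = p.2.2 := by
        by_contra h
        exact hp' (T.mem_facetIndex.2 ⟨(Finset.mem_filter.1 hp).2, h⟩)
      simp only [hI]
      rw [h1, facetNormal_self]
      simp
  rw [hsum, Finset.sum_congr rfl fun z _ => hz z,
    Finset.sum_fiberwise_of_maps_to (g := fun p : Σ K : T.elements, K.1 × K.1 => (p.2.1 : Pt d))
      (fun p _ => hmem p.1 p.2.1), Fintype.sum_sigma]
  refine Finset.sum_congr rfl fun K _ => ?_
  rw [Fintype.sum_prod_type]
  refine Finset.sum_congr rfl fun i _ => ?_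
  rw [Finset.mul_sum]
  refine Finset.sum_congr rfl fun j _ => ?_
  rw [hg K (show (i : Pt d) ∈ T.cell K from subset_convexHull ℝ _ i.2)]
  rfl

end Triangulation

end

/-! ### Lipschitz continuity of continuous `W^{1,∞}` functions on convex open sets -/

section

set_option linter.unusedSectionVars false

variable {d : ℕ} {S : Set (Pt d)}

theorem exists_ae_abs_le {g : Pt d → ℝ} (hg : MemLp g (⊤ : ℝ≥0∞) (volume.restrict S)) :
    ∃ M : ℝ, 0 ≤ M ∧ ∀ᵐ x ∂(volume.restrict S), |g x| ≤ M := by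
  refine ⟨(eLpNorm g ⊤ (volume.restrict S)).toReal, ENNReal.toReal_nonneg, ?_⟩
  filter_upwards [ae_le_eLpNormEssSup (f := g) (μ := volume.restrict S)] with x hx
  rw [← Real.norm_eq_abs, ← toReal_enorm]
  refine ENNReal.toReal_mono hg.2.ne ?_
  rwa [eLpNorm_exponent_top]

theorem norm_le_of_forall_single {ℓ : Pt d →L[ℝ] ℝ} {M : ℝ} (hM : 0 ≤ M)
    (h : ∀ i, |ℓ (EuclideanSpace.single i (1 : ℝ))| ≤ M) : ‖ℓ‖ ≤ d * M := by
  refine ℓ.opNorm_le_bound (by positivity) fun v => ?_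
  have hv : v = ∑ i, v i • EuclideanSpace.single i (1 : ℝ) := by
    have := (EuclideanSpace.basisFun (Fin d) ℝ).sum_repr v
    simpa using this.symm
  conv_lhs => rw [hv]
  rw [map_sum]
  refine (norm_sum_le _ _).trans ?_
  calc ∑ i, ‖ℓ (v i • EuclideanSpace.single i (1 : ℝ))‖ ≤ ∑ _i : Fin d, ‖v‖ * M := by
        refine Finset.sum_le_sum fun i _ => ?_
        rw [map_smul, norm_smul]
        exact mul_le_mul (PiLp.norm_apply_le v i) (h i) (norm_nonneg _) (norm_nonneg _)
    _ = d * M * ‖v‖ := by simp; ring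

/-- The derivatives of the mollifications of a function with bounded weak derivatives are bounded,
away from the boundary. -/
theorem abs_deriv_mollification_le {f g : Pt d → ℝ} {i : Fin d} {M : ℝ}
    (hfg : IsWeakPartialDeriv S i f g) (hS : MeasurableSet S)
    (hM : ∀ᵐ x ∂(volume.restrict S), |g x| ≤ M)
    (φ : ContDiffBump (0 : Pt d)) {x : Pt d} (hx : Metric.closedBall x φ.rOut ⊆ S) :
    |convolution (S.indicator f) (fun a => fderiv ℝ (φ.normed volume) a
      (EuclideanSpace.single i (1 : ℝ))) (ContinuousLinearMap.mul ℝ ℝ) volume x| ≤ M := by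
  set ρ := φ.normed volume with hρ
  set e : Pt d := EuclideanSpace.single i (1 : ℝ)
  -- The reflected and translated mollifier is an admissible test function at `x`; it turns the
  -- derivative of the mollification into an average of `g` with weight `ψ`.
  set ψ : Pt d → ℝ := fun t => ρ (x - t) with hψ
  have hρd : ContDiff ℝ ∞ ρ := φ.contDiff_normed
  have hψd : ContDiff ℝ ∞ ψ := hρd.comp (contDiff_const.sub contDiff_id)
  have hψs : tsupport ψ ⊆ Metric.closedBall x φ.rOut := by
    refine closure_minimal (fun t ht => ?_) Metric.isClosed_closedBall
    have h1 : x - t ∈ Function.support ρ := ht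
    rw [hρ, φ.support_normed_eq, mem_ball_zero_iff] at h1
    rw [mem_closedBall_iff_norm, norm_sub_rev]
    exact h1.le
  have hψc : HasCompactSupport ψ :=
    (isCompact_closedBall x φ.rOut).of_isClosed_subset (isClosed_tsupport ψ) hψs
  have hder : ∀ t, fderiv ℝ ψ t e = -fderiv ℝ ρ (x - t) e := by
    intro t
    have h1 : HasFDerivAt (fun t : Pt d => x - t) (-ContinuousLinearMap.id ℝ (Pt d)) t :=
      (hasFDerivAt_id t).const_sub x
    have h2 := ((hρd.differentiable (by simp)) (x - t)).hasFDerivAt.comp t h1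
    rw [show fderiv ℝ ψ t = _ from h2.fderiv]
    simp
  have hweak := hfg ψ hψd hψc (hψs.trans hx)
  have hconv : convolution (S.indicator f) (fun a => fderiv ℝ ρ a e)
      (ContinuousLinearMap.mul ℝ ℝ) volume x = ∫ t in S, g t * ψ t := by
    rw [← neg_neg (∫ t in S, g t * ψ t), ← hweak, ← integral_neg, convolution_def,
      ← integral_indicator hS]
    congr 1
    funext t
    by_cases ht : t ∈ S
    · simp [ht, e, hder]
    · simp [ht]
  have hψint : ∫ t, ψ t = 1 := by
    rw [hψ, integral_sub_left_eq_self ρ volume x]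
    exact φ.integral_normed
  have hψ0 : ∀ t, 0 ≤ ψ t := fun t => φ.nonneg_normed _
  have hψi : Integrable ψ := hψd.continuous.integrable_of_hasCompactSupport hψc
  rw [hconv, ← Real.norm_eq_abs]
  have hM0 : ∫ t in S, M * ψ t = M := by
    rw [integral_const_mul, setIntegral_eq_integral_of_forall_compl_eq_zero, hψint, mul_one]
    intro t ht
    by_contra hne
    exact ht (hx (hψs (subset_tsupport ψ hne)))
  rw [← hM0]
  refine norm_integral_le_of_norm_le (hψi.const_mul M).integrableOn ?_
  filter_upwards [hM] with t ht
  rw [norm_mul, Real.norm_of_nonneg (hψ0 t), Real.norm_eq_abs]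
  exact mul_le_mul_of_nonneg_right ht (hψ0 t)

/-- The mean value inequality for a mollification along the segment gives a constant independent of
the mollification radius, and continuity lets the radius tend to zero at both end points. -/
theorem MemW1Inf.exists_lipschitz (hS : IsOpen S) (hSc : Convex ℝ S) {f : Pt d → ℝ}
    (hf : MemW1Inf S f) (hfc : ContinuousOn f S) :
    ∃ L : ℝ, 0 ≤ L ∧ ∀ x ∈ S, ∀ y ∈ S, |f x - f y| ≤ L * ‖x - y‖ := by
  obtain ⟨hf0, hf1⟩ := hf
  choose g hg hfg using hf1
  choose M' hM0' hM' using fun i => exists_ae_abs_le (hg i)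
  set M := ∑ i, M' i with hMdef
  have hM0 : 0 ≤ M := Finset.sum_nonneg fun i _ => hM0' i
  have hM : ∀ i, ∀ᵐ x ∂(volume.restrict S), |g i x| ≤ M := fun i => by
    filter_upwards [hM' i] with x hx
    exact hx.trans (Finset.single_le_sum (f := M') (fun i _ => hM0' i) (Finset.mem_univ i))
  have hF : LocallyIntegrable (S.indicator f) volume :=
    ((memLp_indicator_iff_restrict hS.measurableSet).2 hf0).locallyIntegrable le_top
  refine ⟨d * M, by positivity, fun x hx y hy => ?_⟩
  refine le_of_forall_pos_le_add fun η hη => ?_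
  have hseg : segment ℝ x y ⊆ S := hSc.segment_subset hx hy
  have hsegc : IsCompact (segment ℝ x y) := by
    rw [← convexHull_pair]
    exact (Set.toFinite _).isCompact_convexHull ℝ
  obtain ⟨δ, hδ, hδS⟩ := hsegc.exists_cthickening_subset_open hS hseg
  have hcont : ∀ z ∈ S, ∃ δ' > 0, ∀ t ∈ Metric.ball z δ',
      dist (S.indicator f t) (S.indicator f z) ≤ η / 2 := by
    intro z hz
    have h1 : ContinuousAt (S.indicator f) z := by
      refine (hfc.continuousAt (hS.mem_nhds hz)).congr ?_
      filter_upwards [hS.mem_nhds hz] with t ht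
      rw [Set.indicator_of_mem ht]
    obtain ⟨δ', hδ', h2⟩ := Metric.continuousAt_iff.1 h1 (η / 2) (by positivity)
    exact ⟨δ', hδ', fun t ht => (h2 ht).le⟩
  obtain ⟨δx, hδx, hcx⟩ := hcont x hx
  obtain ⟨δy, hδy, hcy⟩ := hcont y hy
  set ε := min δ (min δx δy) with hε
  have hε0 : 0 < ε := by positivity
  -- The radius is at most `δ`, so all balls centred on the segment lie in `S`, and at most `δx`,
  -- `δy`, so the mollification is within `η / 2` of `f` at the end points.
  let φ : ContDiffBump (0 : Pt d) := ⟨ε / 2, ε, by positivity, by linarith⟩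
  set ρ := φ.normed volume with hρ
  set Fε : Pt d → ℝ := convolution (S.indicator f) ρ (ContinuousLinearMap.mul ℝ ℝ) volume with hFε
  have hflip : convolution ρ (S.indicator f) (ContinuousLinearMap.lsmul ℝ ℝ) volume = Fε := by
    rw [hFε, ← convolution_flip]
    congr 1
    ext
    simp
  have hdist : ∀ z, (∃ δ', ε ≤ δ' ∧ ∀ t ∈ Metric.ball z δ',
      dist (S.indicator f t) (S.indicator f z) ≤ η / 2) → z ∈ S → |Fε z - f z| ≤ η / 2 := by
    rintro z ⟨δ', hδ', hb⟩ hz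
    have := φ.dist_normed_convolution_le (μ := volume) (x₀ := z) (ε := η / 2)
      hF.aestronglyMeasurable (fun t ht => hb t (Metric.ball_subset_ball hδ' ht))
    rw [← hρ, hflip, Set.indicator_of_mem hz] at this
    exact this
  have hx1 := hdist x ⟨δx, (min_le_right _ _).trans (min_le_left _ _), hcx⟩ hx
  have hy1 := hdist y ⟨δy, (min_le_right _ _).trans (min_le_right _ _), hcy⟩ hy
  have hρc : HasCompactSupport ρ := φ.hasCompactSupport_normed
  have hρd : ContDiff ℝ 1 ρ := φ.contDiff_normed
  have hder : ∀ z, HasFDerivAt Fε (convolution (S.indicator f) (fderiv ℝ ρ)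
      (ContinuousLinearMap.precompR (Pt d) (ContinuousLinearMap.mul ℝ ℝ)) volume z) z := fun z =>
    hρc.hasFDerivAt_convolution_right _ hF hρd z
  have hbd : ∀ z ∈ segment ℝ x y, ‖convolution (S.indicator f) (fderiv ℝ ρ)
      (ContinuousLinearMap.precompR (Pt d) (ContinuousLinearMap.mul ℝ ℝ)) volume z‖ ≤ d * M := by
    intro z hz
    refine norm_le_of_forall_single hM0 fun i => ?_
    rw [convolution_precompR_apply _ hF (hρc.fderiv ℝ) (hρd.continuous_fderiv (by simp))]
    refine abs_deriv_mollification_le (hfg i) hS.measurableSet (hM i) φ ?_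
    refine Set.Subset.trans ?_ hδS
    exact (Metric.closedBall_subset_closedBall (min_le_left _ _)).trans
      (Metric.closedBall_subset_cthickening hz δ)
  have hmv := (convex_segment x y).norm_image_sub_le_of_norm_hasFDerivWithin_le
    (fun z _ => (hder z).hasFDerivWithinAt) hbd (right_mem_segment ℝ x y) (left_mem_segment ℝ x y)
  rw [Real.norm_eq_abs] at hmv
  calc |f x - f y| = |(Fε x - Fε y) - (Fε x - f x) + (Fε y - f y)| := by congr 1; ring
    _ ≤ |Fε x - Fε y| + |Fε x - f x| + |Fε y - f y| :=
        (abs_add_le _ _).trans (add_le_add_left (abs_sub _ _) _)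
    _ ≤ d * M * ‖x - y‖ + η := by linarith

end

/-! ### Coercivity for coefficients that oscillate little on each element -/

section

set_option linter.unusedSectionVars false

variable {d : ℕ}

theorem matVec_apply (M : Matrix (Fin d) (Fin d) ℝ) (v : Pt d) (i : Fin d) :
    matVec M v i = ∑ j, M i j * v j := rfl

theorem matVec_sub (M N : Matrix (Fin d) (Fin d) ℝ) (v : Pt d) :
    matVec (M - N) v = matVec M v - matVec N v := by
  ext i
  simp [matVec, Matrix.sub_mulVec]

theorem norm_matVec_le {M : Matrix (Fin d) (Fin d) ℝ} {ε : ℝ} (h : ∀ i j, |M i j| ≤ ε) (v : Pt d) :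
    ‖matVec M v‖ ≤ d ^ 2 * ε * ‖v‖ := by
  have hw : matVec M v = ∑ i, matVec M v i • EuclideanSpace.single i (1 : ℝ) := by
    have := (EuclideanSpace.basisFun (Fin d) ℝ).sum_repr (matVec M v)
    simpa using this.symm
  have hi : ∀ i, |matVec M v i| ≤ d * (ε * ‖v‖) := by
    intro i
    rw [matVec_apply]
    refine (Finset.abs_sum_le_sum_abs _ _).trans ?_
    have : ∀ j ∈ (Finset.univ : Finset (Fin d)), |M i j * v j| ≤ ε * ‖v‖ := fun j _ => by
      rw [abs_mul]
      exact mul_le_mul (h i j) (PiLp.norm_apply_le v j) (abs_nonneg _) ((abs_nonneg _).trans (h i j))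
    refine (Finset.sum_le_sum this).trans ?_
    simp
  rw [hw]
  refine (norm_sum_le _ _).trans ?_
  calc ∑ i, ‖matVec M v i • EuclideanSpace.single i (1 : ℝ)‖ ≤ ∑ _i : Fin d, d * (ε * ‖v‖) := by
        refine Finset.sum_le_sum fun i _ => ?_
        rw [norm_smul, PiLp.norm_single, norm_one, mul_one]
        exact hi i
    _ = _ := by simp; ring

theorem isOpen_of_isConvexPolytopalDomain {S : Set (Pt d)} (hS : IsConvexPolytopalDomain S) :
    IsOpen S ∧ Convex ℝ S ∧ Bornology.IsBounded S := by
  obtain ⟨-, F, rfl⟩ := hS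
  exact ⟨isOpen_interior, (convex_convexHull ℝ _).interior,
    (F.finite_toSet.isCompact_convexHull ℝ).isBounded.subset interior_subset⟩

namespace Triangulation

variable {S : Set (Pt d)} (T : Triangulation S)

theorem ae_eq_iUnion_interior (hS : IsOpen S) (hSc : Convex ℝ S) :
    (S : Set (Pt d)) =ᵐ[volume] (⋃ K, interior (T.cell K) : Set (Pt d)) := by
  have hsub : (⋃ K, interior (T.cell K)) ⊆ S := Set.iUnion_subset (T.interior_cell_subset hS hSc)
  refine Filter.EventuallyLE.antisymm (ae_le_set.2 ?_) hsub.eventuallyLE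
  refine measure_mono_null (t := ⋃ K, frontier (T.cell K)) ?_ ?_
  · rintro x ⟨hx, hx'⟩
    obtain ⟨K, hK⟩ := (T.mem_closure_iff_exists_cell x).1 (subset_closure hx)
    exact Set.mem_iUnion.2 ⟨K, subset_closure hK, fun h => hx' (Set.mem_iUnion.2 ⟨K, h⟩)⟩
  · exact measure_iUnion_null fun K => (convex_convexHull ℝ _).addHaar_frontier volume

theorem setIntegral_eq_sum (hS : IsOpen S) (hSc : Convex ℝ S) {f : Pt d → ℝ}
    (hf : ∀ K, IntegrableOn f (interior (T.cell K))) :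
    ∫ x in S, f x = ∑ K, ∫ x in interior (T.cell K), f x := by
  rw [setIntegral_congr_set (T.ae_eq_iUnion_interior hS hSc)]
  refine integral_iUnion_fintype (fun K => isOpen_interior.measurableSet) (fun K K' hne => ?_) hf
  exact Set.disjoint_left.2 fun x hx hx' => hne (T.eq_of_mem_interior K K' hx (interior_subset hx'))

theorem interior_cell_ae_eq (K : T.elements) :
    (interior (T.cell K) : Set (Pt d)) =ᵐ[volume] (T.cell K : Set (Pt d)) :=
  interior_ae_eq_of_null_frontier ((convex_convexHull ℝ _).addHaar_frontier volume)

theorem volume_interior_cell (K : T.elements) :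
    volume (interior (T.cell K)) = volume (T.cell K) :=
  measure_congr (T.interior_cell_ae_eq K)

/-- The squared `H¹` norm is controlled by the vertex values and the elementwise gradients. -/
theorem h1NormSq_le (hS : IsOpen S) (hSc : Convex ℝ S) {χ : Pt d → ℝ}
    {g : T.elements → Pt d →ᵃ[ℝ] ℝ} (hg : ∀ K, Set.EqOn χ (g K) (T.cell K)) :
    h1NormSq S χ ≤ ∑ K, volume.real (T.cell K) *
      (∑ i : K.1, χ i ^ 2 + ‖affineGrad (g K)‖ ^ 2) := by
  have hfin : ∀ K, volume (interior (T.cell K)) ≠ ⊤ := fun K => by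
    rw [volume_interior_cell]; exact (T.isCompact_cell K).measure_lt_top.ne
  have hEq : ∀ K, Set.EqOn (fun x => χ x ^ 2) (fun x => (g K x) ^ 2) (interior (T.cell K)) :=
    fun K x hx => by simp only [hg K (interior_subset hx)]
  have hEq' : ∀ K, Set.EqOn (fun x => ‖gradient χ x‖ ^ 2) (fun _ => ‖affineGrad (g K)‖ ^ 2)
      (interior (T.cell K)) := fun K x hx => by
    simp only [gradient_of_eqOn isOpen_interior ((hg K).mono interior_subset) hx]
  have hint : ∀ K, IntegrableOn (fun x => (g K x) ^ 2) (interior (T.cell K)) := fun K =>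
    (((continuous_affine (g K)).pow 2).continuousOn.integrableOn_compact
      (T.isCompact_cell K)).mono_set interior_subset
  rw [h1NormSq, T.setIntegral_eq_sum hS hSc, T.setIntegral_eq_sum hS hSc,
    ← Finset.sum_add_distrib]
  · refine Finset.sum_le_sum fun K _ => ?_
    rw [mul_add]
    refine add_le_add ?_ ?_
    · rw [setIntegral_congr_fun isOpen_interior.measurableSet (hEq K)]
      have hbound : ∀ x ∈ interior (T.cell K), (g K x) ^ 2 ≤ ∑ i : K.1, χ i ^ 2 := by
        intro x hx
        have h0 : ∀ i : K.1, 0 ≤ (T.elemBasis K).coord i x := fun i => by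
          rw [← lam_coe]; exact (T.mem_cell_iff K x).1 (interior_subset hx) _
        have h1 := (T.elemBasis K).sum_coord_apply_eq_one x
        have hle : ∀ i : K.1, (T.elemBasis K).coord i x ≤ 1 := fun i => by
          rw [← h1]
          exact Finset.single_le_sum (f := fun i => (T.elemBasis K).coord i x) (fun i _ => h0 i)
            (Finset.mem_univ i)
        rw [affine_eq_sum_coord (T.elemBasis K) (g K) x]
        -- Jensen's inequality for the square, followed by `λ_i ≤ 1`.
        refine ((Even.convexOn_pow (n := 2) (by norm_num)).map_sum_le (t := Finset.univ)
          (w := fun i => (T.elemBasis K).coord i x)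
          (p := fun i => g K (T.elemBasis K i)) (fun i _ => h0 i) h1 (fun i _ => trivial)).trans ?_
        refine Finset.sum_le_sum fun i _ => ?_
        rw [hg K (show (i : Pt d) ∈ T.cell K from subset_convexHull ℝ _ i.2), smul_eq_mul]
        exact mul_le_of_le_one_left (sq_nonneg _) (hle i)
      refine (setIntegral_mono_on (hint K) (integrableOn_const (hfin K)) isOpen_interior.measurableSet
        hbound).trans ?_
      rw [setIntegral_const, measureReal_def, volume_interior_cell, smul_eq_mul, measureReal_def]
    · rw [setIntegral_congr_fun isOpen_interior.measurableSet (hEq' K), setIntegral_const,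
        measureReal_def, volume_interior_cell, smul_eq_mul, measureReal_def]
  · exact fun K => (integrableOn_congr_fun (hEq' K) isOpen_interior.measurableSet).2
      (integrableOn_const (hfin K))
  · exact fun K => (integrableOn_congr_fun (hEq K) isOpen_interior.measurableSet).2 (hint K)

theorem transfer_eq_of_mem_openCorner {bc : BoundaryCondition} {χ : Pt d → ℝ}
    (hχ : χ ∈ T.trialSpace bc) (K : T.elements) (i : K.1) {x : Pt d}
    (hx : x ∈ openCorner (T.elemBasis K) i) : T.transfer bc χ x = χ i := by
  classical
  have hxK : x ∈ T.cell K := interior_subset (by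
    rw [cell_eq, AffineBasis.interior_convexHull]; exact hx.1)
  have hiff : ∀ z, x ∈ T.dualCell z ↔ z = i := by
    intro z
    rw [T.mem_dualCell_iff hxK]
    constructor
    · intro h
      by_contra hne
      have h1 := h i
      rw [lam_coe] at h1
      by_cases hz : z ∈ K.1
      · have h2 := hx.2 ⟨z, hz⟩ (fun h => hne (congrArg Subtype.val h))
        rw [← lam_coe] at h2
        exact absurd h1 (not_le.2 h2)
      · rw [T.lam_of_notMem K hz] at h1
        exact absurd h1 (not_le.2 (hx.1 i))
    · rintro rfl y
      rw [lam_coe]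
      by_cases hy : y ∈ K.1
      · rw [show y = ((⟨y, hy⟩ : K.1) : Pt d) from rfl, lam_coe]
        by_cases hyi : (⟨y, hy⟩ : K.1) = i
        · rw [hyi]
        · exact (hx.2 _ hyi).le
      · rw [T.lam_of_notMem K hy]; exact (hx.1 i).le
  have hterm : ∀ z, χ z * (T.dualCell z).indicator 1 x = if z = i then χ z else 0 := fun z => by
    by_cases h : z = i
    · rw [Set.indicator_of_mem ((hiff z).2 h), if_pos h]; simp
    · rw [Set.indicator_of_notMem (fun h' => h ((hiff z).1 h')), if_neg h]; simp
  rw [transfer, Finset.sum_congr rfl fun z _ => hterm z, Finset.sum_ite_eq']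
  split_ifs with h
  · rfl
  -- At an inactive vertex the transfer is `0`, and so is the value of `χ`.
  · refine (hχ.2.2.1 i ?_ h).symm
    rw [Geometry.SimplicialComplex.vertices_eq]
    exact Set.mem_biUnion (T.mem_elements.1 K.2).1 i.2

theorem measurable_transfer (bc : BoundaryCondition) (χ : Pt d → ℝ) :
    Measurable (T.transfer bc χ) :=
  Finset.measurable_fun_sum _ fun z _ => measurable_const.mul
    (measurable_one.indicator (T.isClosed_dualCell z).measurableSet)

theorem abs_transfer_le (bc : BoundaryCondition) (χ : Pt d → ℝ) (x : Pt d) :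
    |T.transfer bc χ x| ≤ ∑ z ∈ T.activeVertices bc, |χ z| := by
  refine (Finset.abs_sum_le_sum_abs _ _).trans (Finset.sum_le_sum fun z _ => ?_)
  rw [abs_mul]
  refine mul_le_of_le_one_right (abs_nonneg _) ?_
  by_cases h : x ∈ T.dualCell z <;> simp [h]

/-- The reaction term dominates the vertex values. -/
theorem mass_ge (hS : IsOpen S) (hSc : Convex ℝ S) (hSb : Bornology.IsBounded S) {τ : ℝ}
    (hτ : IsCornerConstant d τ) {κ : Pt d → ℝ} (hκ : MemLp κ (⊤ : ℝ≥0∞) (volume.restrict S))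
    {κ₀ : ℝ} (hκ₀ : 0 < κ₀) (hκ_pos : ∀ᵐ x ∂(volume.restrict S), κ₀ ≤ κ x)
    {bc : BoundaryCondition} {χ : Pt d → ℝ} (hχ : χ ∈ T.trialSpace bc) :
    κ₀ ^ 2 * τ * ∑ K, volume.real (T.cell K) * ∑ i : K.1, χ i ^ 2 ≤
      ∫ x in S, κ x ^ 2 * T.transfer bc χ x * T.transfer bc χ x := by
  set Q := T.transfer bc χ with hQ
  have hSfin : volume S < ⊤ := hSb.measure_lt_top
  have : IsFiniteMeasure (volume.restrict S) := ⟨by simpa using hSfin⟩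
  have hint : IntegrableOn (fun x => κ x ^ 2 * Q x * Q x) S := by
    have h1 : Integrable (fun x => κ x ^ 2) (volume.restrict S) :=
      (hκ.mono_exponent (p := 2) le_top).integrable_sq
    have hb : ∀ᵐ x ∂(volume.restrict S), ‖Q x‖ ≤ ∑ z ∈ T.activeVertices bc, |χ z| :=
      Filter.Eventually.of_forall fun x => T.abs_transfer_le bc χ x
    have hm := (T.measurable_transfer bc χ).aestronglyMeasurable (μ := volume.restrict S)
    exact (h1.mul_bdd hm hb).mul_bdd hm hb
  set O : (Σ K : T.elements, K.1) → Set (Pt d) := fun p => openCorner (T.elemBasis p.1) p.2 with hO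
  have hOint : ∀ p, O p ⊆ interior (T.cell p.1) := fun p x hx => by
    rw [cell_eq, AffineBasis.interior_convexHull]; exact hx.1
  have hOS : ∀ p, O p ⊆ S := fun p => (hOint p).trans (T.interior_cell_subset hS hSc p.1)
  have hOm : ∀ p, MeasurableSet (O p) := fun p => (isOpen_openCorner _ _).measurableSet
  have hOd : Pairwise (Function.onFun Disjoint O) := by
    intro p q hpq
    refine Set.disjoint_left.2 fun x hx hx' => hpq ?_
    have hK : p.1 = q.1 := T.eq_of_mem_interior p.1 q.1 (hOint p hx) (interior_subset (hOint q hx'))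
    rcases p with ⟨K, i⟩
    rcases q with ⟨K', j⟩
    dsimp only at hK
    subst hK
    by_contra hne
    have hij : i ≠ j := fun h => hne (by rw [h])
    exact lt_asymm (hx.2 j hij.symm) (hx'.2 i hij)
  have hOfin : ∀ p, volume (O p) ≠ ⊤ := fun p => ((measure_mono (hOS p)).trans_lt hSfin).ne
  -- On the open corner of a vertex the transfer equals the vertex value. The corners are disjoint
  -- and the integrand is nonnegative, so the rest of `S` can be discarded.
  have hlow : ∀ p : (Σ K : T.elements, K.1), κ₀ ^ 2 * χ p.2 ^ 2 * (τ * volume.real (T.cell p.1)) ≤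
      ∫ x in O p, κ x ^ 2 * Q x * Q x := by
    intro p
    rw [cell_eq, ← hτ.2 p.1.1 (T.elemBasis p.1) p.2, mul_comm, ← smul_eq_mul,
      ← setIntegral_const]
    refine setIntegral_mono_on_ae (integrableOn_const (hOfin p)) (hint.mono_set (hOS p)) (hOm p) ?_
    have := (ae_restrict_iff' hS.measurableSet).1 hκ_pos
    filter_upwards [this] with x hx hxO
    rw [hQ, T.transfer_eq_of_mem_openCorner hχ p.1 p.2 hxO, mul_assoc, ← sq]
    have := hx (hOS p hxO)
    gcongr
  have hnonneg : ∀ x, 0 ≤ κ x ^ 2 * Q x * Q x := fun x => by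
    rw [mul_assoc]; exact mul_nonneg (sq_nonneg _) (mul_self_nonneg _)
  calc κ₀ ^ 2 * τ * ∑ K, volume.real (T.cell K) * ∑ i : K.1, χ i ^ 2
      = ∑ p : (Σ K : T.elements, K.1), κ₀ ^ 2 * χ p.2 ^ 2 * (τ * volume.real (T.cell p.1)) := by
        rw [Fintype.sum_sigma, Finset.mul_sum]
        refine Finset.sum_congr rfl fun K _ => ?_
        rw [Finset.mul_sum, Finset.mul_sum]
        exact Finset.sum_congr rfl fun i _ => by ring
    _ ≤ ∑ p, ∫ x in O p, κ x ^ 2 * Q x * Q x := Finset.sum_le_sum fun p _ => hlow p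
    _ = ∫ x in ⋃ p, O p, κ x ^ 2 * Q x * Q x :=
        (integral_iUnion_fintype hOm hOd fun p => hint.mono_set (hOS p)).symm
    _ ≤ ∫ x in S, κ x ^ 2 * Q x * Q x :=
        setIntegral_mono_set hint (Filter.Eventually.of_forall hnonneg)
          (Set.iUnion_subset hOS).eventuallyLE

/-- Ellipticity of the box form for coefficients that oscillate little on the elements. -/
theorem boxForm_ge (hS : IsOpen S) (hSc : Convex ℝ S) (hSb : Bornology.IsBounded S) {m τ : ℝ}
    (hm : IsFacetConstant d m) (hτ : IsCornerConstant d τ)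
    {κ : Pt d → ℝ} (hκ : MemLp κ (⊤ : ℝ≥0∞) (volume.restrict S))
    {κ₀ : ℝ} (hκ₀ : 0 < κ₀) (hκ_pos : ∀ᵐ x ∂(volume.restrict S), κ₀ ≤ κ x)
    {σ : ℝ} (hσ : 0 < σ) (hT : ∀ K ∈ T.elements, σ * Metric.diam (convexHull ℝ (K : Set (Pt d))) ≤
      inscribedDiam (convexHull ℝ (K : Set (Pt d))))
    {B : Pt d → Matrix (Fin d) (Fin d) ℝ} (B₀ : T.elements → Matrix (Fin d) (Fin d) ℝ)
    (hBc : ∀ K, ContinuousOn B (interior (T.cell K))) {α δ : ℝ} (hα : 0 < α) (hδ : 0 ≤ δ)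
    (hosc : ∀ K, ∀ x ∈ interior (T.cell K), ∀ v, ‖matVec (B x) v - matVec (B₀ K) v‖ ≤ δ * ‖v‖)
    (hell : ∀ K v, α * ‖v‖ ^ 2 ≤ inner ℝ (matVec (B₀ K) v) v)
    (hδα : (d + 1) * (2 / σ) * δ ≤ α)
    {bc : BoundaryCondition} {χ : Pt d → ℝ} (hχ : χ ∈ T.trialSpace bc) :
    min (m * (d + 1) * (α / 2)) (κ₀ ^ 2 * τ) * h1NormSq S χ ≤ T.boxForm bc κ B χ χ := by
  choose g hg using fun K : T.elements => hχ.2.1 K.1 K.2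
  have hg : ∀ K, Set.EqOn χ (g K) (T.cell K) := hg
  have hint : ∀ (K : T.elements) (i j : K.1), i ≠ j →
      IntegrableOn (fun x => matVec (B x) (affineGrad (g K))) (facet (T.elemBasis K) i j)
        μHE[d - 1] := by
    intro K i j hij
    have hsub : facet (T.elemBasis K) i j ⊆ interior (T.cell K) := fun x hx => by
      rw [cell_eq, AffineBasis.interior_convexHull]; exact hx.1
    have hmeas := measurableSet_facet (T.elemBasis K) i j
    have hcont : ContinuousOn (fun x => matVec (B x) (affineGrad (g K))) (interior (T.cell K)) := by
      have h1 : ContinuousOn (fun x => (B x).mulVec (affineGrad (g K)).ofLp)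
          (interior (T.cell K)) := by
        have h2 : Continuous fun M : Matrix (Fin d) (Fin d) ℝ => M.mulVec (affineGrad (g K)).ofLp :=
          continuous_id.matrix_mulVec continuous_const
        exact h2.comp_continuousOn (hBc K)
      exact (PiLp.continuous_toLp 2 _).comp_continuousOn h1
    have hfin : μHE[d - 1] (facet (T.elemBasis K) i j) < ⊤ := by
      rw [hm.2 K.1 (T.elemBasis K) i j hij]; exact ENNReal.ofReal_lt_top
    have : IsFiniteMeasure (μHE[d - 1].restrict (facet (T.elemBasis K) i j)) :=
      ⟨by simpa using hfin⟩
    refine Integrable.of_bound ((hcont.mono hsub).aestronglyMeasurable hmeas)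
      (‖matVec (B₀ K) (affineGrad (g K))‖ + δ * ‖affineGrad (g K)‖)
      ((ae_restrict_mem hmeas).mono fun x hx => ?_)
    have h1 := hosc K x (hsub hx) (affineGrad (g K))
    have h2 := norm_le_norm_add_norm_sub' (matVec (B x) (affineGrad (g K)))
      (matVec (B₀ K) (affineGrad (g K)))
    linarith
  -- With `R = 2 / σ`, the bound on `δ` makes the error term at most `(d + 1) α ‖∇g‖² / 2`, half of
  -- the elliptic contribution.
  have hflux : m * (d + 1) * (α / 2) * ∑ K, volume.real (T.cell K) * ‖affineGrad (g K)‖ ^ 2 ≤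
      -∑ z ∈ T.activeVertices bc, χ z * T.flux B χ z := by
    rw [T.sum_flux_eq hS hSc bc B hχ hg hint, ← Finset.sum_neg_distrib, Finset.mul_sum]
    refine Finset.sum_le_sum fun K _ => ?_
    have hsh := norm_sub_mul_norm_grad_le hσ (T.elemBasis K) (by
      rw [range_elemBasis]; exact hT K.1 K.2)
    refine le_trans ?_ (element_flux_ge hm (T.elemBasis K) (g K)
      (fun x => matVec (B x) (affineGrad (g K))) (matVec (B₀ K) (affineGrad (g K))) hδ hsh (hint K)
      (fun x hx => hosc K x (by rwa [cell_eq]) _))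
    rw [← cell_eq]
    have h1 := hell K (affineGrad (g K))
    have h2 : 0 ≤ m * volume.real (T.cell K) := mul_nonneg hm.1.le measureReal_nonneg
    have h3 : (d + 1 : ℝ) * ((d + 1) * (2 / σ) * δ) * ‖affineGrad (g K)‖ ^ 2 ≤
        (d + 1) * α * ‖affineGrad (g K)‖ ^ 2 := by gcongr
    have h4 : (d + 1 : ℝ) * (α * ‖affineGrad (g K)‖ ^ 2) ≤
        (d + 1) * inner ℝ (matVec (B₀ K) (affineGrad (g K))) (affineGrad (g K)) := by gcongr
    calc m * (d + 1) * (α / 2) * (volume.real (T.cell K) * ‖affineGrad (g K)‖ ^ 2)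
        = m * volume.real (T.cell K) * ((d + 1) * (α / 2) * ‖affineGrad (g K)‖ ^ 2) := by ring
      _ ≤ _ := by
        refine mul_le_mul_of_nonneg_left ?_ h2
        linarith
  have hmass := T.mass_ge hS hSc hSb hτ hκ hκ₀ hκ_pos hχ
  have hh1 := T.h1NormSq_le hS hSc hg
  set c := min (m * (d + 1) * (α / 2)) (κ₀ ^ 2 * τ) with hc
  have hc0 : 0 ≤ c := le_min (by have := hm.1; positivity) (by have := hτ.1; positivity)
  have hG : 0 ≤ ∑ K, volume.real (T.cell K) * ‖affineGrad (g K)‖ ^ 2 :=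
    Finset.sum_nonneg fun K _ => mul_nonneg measureReal_nonneg (sq_nonneg _)
  have hV : 0 ≤ ∑ K, volume.real (T.cell K) * ∑ i : K.1, χ i ^ 2 :=
    Finset.sum_nonneg fun K _ => mul_nonneg measureReal_nonneg
      (Finset.sum_nonneg fun i _ => sq_nonneg _)
  simp only [mul_add, Finset.sum_add_distrib] at hh1
  calc c * h1NormSq S χ ≤ c * _ := mul_le_mul_of_nonneg_left hh1 hc0
    _ = c * ∑ K, volume.real (T.cell K) * ‖affineGrad (g K)‖ ^ 2 +
        c * ∑ K, volume.real (T.cell K) * ∑ i : K.1, χ i ^ 2 := by ring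
    _ ≤ _ := add_le_add ((mul_le_mul_of_nonneg_right (min_le_left _ _) hG).trans hflux)
        ((mul_le_mul_of_nonneg_right (min_le_right _ _) hV).trans hmass)

theorem diam_cell_le_meshSize (K : T.elements) : Metric.diam (T.cell K) ≤ T.meshSize :=
  le_csSup (T.elements.finite_toSet.image _).bddAbove ⟨K.1, K.2, rfl⟩

/-- The average of the matrix field over an element. -/
def avg (A : Pt d → Matrix (Fin d) (Fin d) ℝ) (K : T.elements) : Matrix (Fin d) (Fin d) ℝ :=
  Matrix.of fun i j => ⨍ y in T.cell K, A y i j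

theorem elementAverage_eq (A : Pt d → Matrix (Fin d) (Fin d) ℝ) (K : T.elements) {x : Pt d}
    (hx : x ∈ interior (T.cell K)) : T.elementAverage A x = T.avg A K := by
  rw [elementAverage, Finset.sum_eq_single_of_mem K.1 K.2]
  · exact Set.indicator_of_mem hx _
  · intro K' hK' hne
    refine Set.indicator_of_notMem (fun hx' => hne ?_) _
    exact congrArg Subtype.val (T.eq_of_mem_interior ⟨K', hK'⟩ K hx' (interior_subset hx))

/-- The quadratic form is linear in the matrix, so the pointwise inequality can be averaged. The
average is taken over the interior of the cell, which lies in `S`, where ellipticity is known; the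
boundary of the cell is null. -/
theorem le_inner_avg (hS : IsOpen S) (hSc : Convex ℝ S) (hSb : Bornology.IsBounded S)
    {A : Pt d → Matrix (Fin d) (Fin d) ℝ}
    (hA : ∀ i j, MemLp (fun x => A x i j) (⊤ : ℝ≥0∞) (volume.restrict S)) {α : ℝ}
    (hell : ∀ x ∈ S, ∀ v : Pt d, α * ‖v‖ ^ 2 ≤ inner ℝ (matVec (A x) v) v) (K : T.elements)
    (v : Pt d) : α * ‖v‖ ^ 2 ≤ inner ℝ (matVec (T.avg A K) v) v := by
  have : IsFiniteMeasure (volume.restrict S) := ⟨by simpa using hSb.measure_lt_top⟩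
  set I := interior (T.cell K) with hI
  have hIS : I ⊆ S := T.interior_cell_subset hS hSc K
  have hAi : ∀ i j, IntegrableOn (fun x => A x i j) I := fun i j =>
    IntegrableOn.mono_set (t := S) ((hA i j).integrable le_top) hIS
  have hexp : ∀ M : Matrix (Fin d) (Fin d) ℝ, inner ℝ (matVec M v) v =
      ∑ i, (∑ j, M i j * v j) * v i := fun M => by
    rw [inner_matVec]; rfl
  have hVpos : 0 < volume.real I := by
    rw [measureReal_def, hI, volume_interior_cell, cell_eq]
    exact ENNReal.toReal_pos (volume_simplex_pos _).ne' (volume_simplex_lt_top _).ne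
  have havg : ∀ i j, T.avg A K i j = (volume.real I)⁻¹ * ∫ y in I, A y i j := fun i j => by
    rw [avg, Matrix.of_apply, ← setAverage_congr (T.interior_cell_ae_eq K),
      setAverage_eq, smul_eq_mul]
  have hint : IntegrableOn (fun y => inner ℝ (matVec (A y) v) v) I := by
    simp only [hexp]
    exact integrable_finsetSum _ fun i _ =>
      (integrable_finsetSum _ fun j _ => (hAi i j).mul_const _).mul_const _
  have hkey : inner ℝ (matVec (T.avg A K) v) v =
      (volume.real I)⁻¹ * ∫ y in I, inner ℝ (matVec (A y) v) v := by
    simp only [hexp, havg]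
    rw [integral_finsetSum _ fun i _ =>
      (integrable_finsetSum _ fun j _ => (hAi i j).mul_const _).mul_const _, Finset.mul_sum]
    refine Finset.sum_congr rfl fun i _ => ?_
    rw [integral_mul_const, integral_finsetSum _ fun j _ => (hAi i j).mul_const _, ← mul_assoc,
      Finset.mul_sum]
    congr 1
    exact Finset.sum_congr rfl fun j _ => by rw [integral_mul_const, mul_assoc]
  have hfin : volume I ≠ ⊤ := ((measure_mono hIS).trans_lt hSb.measure_lt_top).ne
  rw [hkey, ← div_eq_inv_mul, le_div_iff₀ hVpos, mul_comm, ← smul_eq_mul, ← setIntegral_const]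
  exact setIntegral_mono_on (integrableOn_const hfin) hint isOpen_interior.measurableSet
    fun x hx => hell x (hIS hx) v

end Triangulation

end

end BoxMethod

end

/-! ### Conclusion: uniform ellipticity for small mesh size -/

theorem theorem2p3 {d : ℕ} (hd : d = 1 ∨ d = 2 ∨ d = 3)
    (S : Set (BoxMethod.Pt d)) (hS : BoxMethod.IsConvexPolytopalDomain S)
    (bc : BoxMethod.BoundaryCondition)
    (A : BoxMethod.Pt d → Matrix (Fin d) (Fin d) ℝ)
    (hA : ∀ i j, BoxMethod.MemW1Inf S fun x => A x i j)
    -- `A` denotes the continuous representative of its class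
    (hA_cont : ContinuousOn A S)
    (hA_symm : ∀ x ∈ S, (A x).IsSymm)
    (hA_ell : ∃ α > (0 : ℝ), ∀ x ∈ S, ∀ ξ : Fin d → ℝ, α * (ξ ⬝ᵥ ξ) ≤ (A x).mulVec ξ ⬝ᵥ ξ)
    (κ : BoxMethod.Pt d → ℝ) (hκ : BoxMethod.MemW1Inf S κ)
    (hκ_pos : ∃ κ₀ > (0 : ℝ), ∀ᵐ x ∂(volume.restrict S), κ₀ ≤ κ x)
    {ι : Type*} (T : ι → BoxMethod.Triangulation S)
    (hT : ∃ σ > (0 : ℝ), BoxMethod.ShapeRegular T σ) :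
    ∃ c > (0 : ℝ), ∃ h₀ > (0 : ℝ), ∀ i, (T i).meshSize < h₀ → ∀ χ ∈ (T i).trialSpace bc,
      c * BoxMethod.h1NormSq S χ ≤ (T i).boxForm bc κ A χ χ ∧
      c * BoxMethod.h1NormSq S χ ≤ (T i).boxForm bc κ ((T i).elementAverage A) χ χ := by
  obtain ⟨hSo, hSc, hSb⟩ := BoxMethod.isOpen_of_isConvexPolytopalDomain hS
  obtain ⟨⟨m, hm⟩, τ, hτ⟩ := BoxMethod.exists_facetConstant_cornerConstant (d := d) (by omega)
  obtain ⟨α, hα, hell⟩ := hA_ell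
  obtain ⟨κ₀, hκ₀, hκ_pos⟩ := hκ_pos
  obtain ⟨σ, hσ, hT⟩ := hT
  have hell : ∀ x ∈ S, ∀ v : BoxMethod.Pt d,
      α * ‖v‖ ^ 2 ≤ inner ℝ (BoxMethod.matVec (A x) v) v := fun x hx v => by
    rw [BoxMethod.inner_matVec, ← real_inner_self_eq_norm_sq, ← BoxMethod.dotProduct_ofLp]
    exact hell x hx v.ofLp
  have hA_entry : ∀ i j, ContinuousOn (fun x => A x i j) S := fun i j =>
    ((continuous_apply_apply i j).comp_continuousOn hA_cont :)
  choose L hL0 hL using fun i j => (hA i j).exists_lipschitz hSo hSc (hA_entry i j)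
  set Λ := ∑ i, ∑ j, L i j with hΛ
  have hΛ0 : 0 ≤ Λ := Finset.sum_nonneg fun i _ => Finset.sum_nonneg fun j _ => hL0 i j
  have hLΛ : ∀ i j, L i j ≤ Λ := fun i j =>
    (Finset.single_le_sum (f := fun j => L i j) (fun j _ => hL0 i j) (Finset.mem_univ j)).trans
      (Finset.single_le_sum (f := fun i => ∑ j, L i j)
        (fun i _ => Finset.sum_nonneg fun j _ => hL0 i j) (Finset.mem_univ i))
  -- The oscillation of `A` on an element is at most `δ = d² Λ h`, so the smallness condition of
  -- `boxForm_ge` reads `D h ≤ α`. The threshold `α / (D + 1)` avoids dividing by zero.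
  set D : ℝ := (d + 1) * (2 / σ) * (d ^ 2 * Λ) with hD
  have hD0 : 0 ≤ D := by positivity
  refine ⟨min (m * (d + 1) * (α / 2)) (κ₀ ^ 2 * τ), lt_min (by have := hm.1; positivity)
    (by have := hτ.1; positivity), α / (D + 1), by positivity, fun i hi χ hχ => ⟨?_, ?_⟩⟩
  · have hc : ∀ K, ∃ c, c ∈ interior ((T i).cell K) := fun K => by
      rw [BoxMethod.Triangulation.cell_eq]
      exact ⟨_, ((T i).elemBasis K).centroid_mem_interior_convexHull⟩
    choose c hc using hc
    -- An element is used to see that the mesh size is nonnegative; without elements, the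
    -- elementwise conditions are void and `δ = 0` serves.
    rcases isEmpty_or_nonempty (T i).elements with hE | ⟨⟨K₀⟩⟩
    · refine (T i).boxForm_ge hSo hSc hSb hm hτ hκ.1 hκ₀ hκ_pos hσ (hT i) (fun K => A (c K))
        (fun K => (hE.false K).elim) hα le_rfl (fun K => (hE.false K).elim)
        (fun K => (hE.false K).elim) (by simpa using hα.le) hχ
    have hmesh : 0 ≤ (T i).meshSize :=
      Metric.diam_nonneg.trans ((T i).diam_cell_le_meshSize K₀)
    refine (T i).boxForm_ge hSo hSc hSb hm hτ hκ.1 hκ₀ hκ_pos hσ (hT i) (fun K => A (c K))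
      (δ := d ^ 2 * (Λ * (T i).meshSize))
      (fun K => hA_cont.mono ((T i).interior_cell_subset hSo hSc K)) hα (by positivity)
      (fun K x hx v => ?_) (fun K v => hell _ ((T i).interior_cell_subset hSo hSc K (hc K)) v) ?_ hχ
    · rw [← BoxMethod.matVec_sub]
      refine BoxMethod.norm_matVec_le (fun k l => ?_) v
      rw [Matrix.sub_apply]
      refine (hL k l x ((T i).interior_cell_subset hSo hSc K hx) (c K)
        ((T i).interior_cell_subset hSo hSc K (hc K))).trans ?_
      refine mul_le_mul (hLΛ k l) ?_ (norm_nonneg _) hΛ0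
      rw [← dist_eq_norm]
      exact (Metric.dist_le_diam_of_mem ((T i).isCompact_cell K).isBounded (interior_subset hx)
        (interior_subset (hc K))).trans ((T i).diam_cell_le_meshSize K)
    · rw [lt_div_iff₀ (by positivity)] at hi
      calc (d + 1) * (2 / σ) * (d ^ 2 * (Λ * (T i).meshSize)) = (T i).meshSize * D := by
            rw [hD]; ring
        _ ≤ (T i).meshSize * (D + 1) := by gcongr; linarith
        _ ≤ α := hi.le
  · refine (T i).boxForm_ge hSo hSc hSb hm hτ hκ.1 hκ₀ hκ_pos hσ (hT i) ((T i).avg A)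
      (fun K => ?_) hα le_rfl (fun K x hx v => ?_)
      ((T i).le_inner_avg hSo hSc hSb (fun k l => (hA k l).1) hell) (by simpa using hα.le) hχ
    · exact continuousOn_const.congr fun x hx => (T i).elementAverage_eq A K hx
    · rw [(T i).elementAverage_eq A K hx, sub_self]; simp
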